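/- Let $\mathbb{G}=(A,\Delta)$ be a compact quantum group, that is, $A=C(\mathbb{G})$ is a unital $C^*$-algebra and $\Delta:A\to A\otimes A$ (minimal tensor product) is a unital $*$-homomorphism with $(\Delta\otimes\mathrm{id})\Delta=(\mathrm{id}\otimes\Delta)\Delta$ such that the linear spans of $\Delta(A)(1\otimes A)$ and of $\Delta(A)(A\otimes 1)$ are dense in $A\otimes A$. Assume that $\mathbb{G}$ is of Kac type, i.e. its Haar state $h$ (the state with $(h\otimes\mathrm{id})\Delta(a)=h(a)1=(\mathrm{id}\otimes h)\Delta(a)$ for all $a\in A$) is a trace, and that $h$ is faithful. Let $\Sigma:A\otimes A\to A\otimes A$, $a\otimes b\mapsto b\otimes a$, be the flip, let $\mathrm{Pol}(\mathbb{G})\subset A$ be the linear span of the matrix coefficients $u_{ij}$ of the irreducible finite-dimensional unitary corepresentations $u=(u_{ij})$ of $\mathbb{G}$, and put $$C(\mathbb{G})_{\mathrm{central}}=\{a\in A:\Delta(a)=\Sigma\circ\Delta(a)\},\qquad \mathrm{Pol}(\mathbb{G})_{\mathrm{central}}=\{a\in \mathrm{Pol}(\mathbb{G}):\Delta(a)=\Sigma\circ\Delta(a)\}.$$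 Then $$\overline{\mathrm{Pol}(\mathbb{G})_{\mathrm{central}}}^{\|\cdot\|}=C(\mathbb{G})_{\mathrm{central}},$$ and $\mathrm{Pol}(\mathbb{G})_{\mathrm{central}}$ is the linear span of the irreducible characters $\chi_u=\sum_i u_{ii}$; in particular the span of the irreducible characters is norm-dense in $C(\mathbb{G})_{\mathrm{central}}$. -/

import Mathlib

universe u

namespace CStarTensor

noncomputable section

open scoped TensorProduct InnerProductSpace ComplexOrder
open UniformSpace

/-- The Hilbert space tensor product of two complex inner product spaces. -/
def HilbertTensor (H K : Type u) [NormedAddCommGroup H] [InnerProductSpace ℂ H]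
    [NormedAddCommGroup K] [InnerProductSpace ℂ K] : Type u :=
  Completion (H ⊗[ℂ] K)

section Operators

variable {H K : Type u} [NormedAddCommGroup H] [InnerProductSpace ℂ H]
  [NormedAddCommGroup K] [InnerProductSpace ℂ K]

instance : NormedAddCommGroup (HilbertTensor H K) :=
  inferInstanceAs (NormedAddCommGroup (Completion (H ⊗[ℂ] K)))

instance : InnerProductSpace ℂ (HilbertTensor H K) :=
  inferInstanceAs (InnerProductSpace ℂ (Completion (H ⊗[ℂ] K)))

instance : CompleteSpace (HilbertTensor H K) :=
  inferInstanceAs (CompleteSpace (Completion (H ⊗[ℂ] K)))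

/-- The canonical isometry from the algebraic tensor product, with dense range. -/
def HilbertTensor.of (H K : Type u) [NormedAddCommGroup H] [InnerProductSpace ℂ H]
    [NormedAddCommGroup K] [InnerProductSpace ℂ K] : H ⊗[ℂ] K →ₗᵢ[ℂ] HilbertTensor H K :=
  (Completion.toComplₗᵢ : H ⊗[ℂ] K →ₗᵢ[ℂ] Completion (H ⊗[ℂ] K))

theorem HilbertTensor.denseRange_of : DenseRange (HilbertTensor.of H K) :=
  Completion.denseRange_coe (α := H ⊗[ℂ] K)

/-- The elementary tensor `x ⊗ y` in the Hilbert space tensor product. -/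
def htmul (x : H) (y : K) : HilbertTensor H K := HilbertTensor.of H K (x ⊗ₜ y)

theorem inner_htmul (x x' : H) (y y' : K) :
    ⟪htmul x y, htmul x' y'⟫_ℂ = ⟪x, x'⟫_ℂ * ⟪y, y'⟫_ℂ := by
  simp [htmul]

/-- The operator `S ⊗ T` on the Hilbert space tensor product. -/
def opTensor (S : H →L[ℂ] H) (T : K →L[ℂ] K) : HilbertTensor H K →L[ℂ] HilbertTensor H K :=
  ((TensorProduct.mapL S T).completion : Completion (H ⊗[ℂ] K) →L[ℂ] Completion (H ⊗[ℂ] K))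

theorem opTensor_of (S : H →L[ℂ] H) (T : K →L[ℂ] K) (x : H ⊗[ℂ] K) :
    opTensor S T (HilbertTensor.of H K x) = HilbertTensor.of H K (TensorProduct.mapL S T x) :=
  ContinuousLinearMap.completion_apply_coe (TensorProduct.mapL S T) x

theorem opTensor_htmul (S : H →L[ℂ] H) (T : K →L[ℂ] K) (x : H) (y : K) :
    opTensor S T (htmul x y) = htmul (S x) (T y) := by
  rw [htmul, opTensor_of, TensorProduct.mapL_tmul, htmul]

theorem clm_ext {E : Type*} [NormedAddCommGroup E] [NormedSpace ℂ E]
    {S T : HilbertTensor H K →L[ℂ] E}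
    (h : ∀ (x : H) (y : K), S (htmul x y) = T (htmul x y)) : S = T := by
  ext z
  refine isClosed_property (p := fun z => S z = T z) HilbertTensor.denseRange_of
    (isClosed_eq S.continuous T.continuous) (fun z => ?_) z
  induction z using TensorProduct.induction_on with
  | zero => rw [map_zero, map_zero, map_zero]
  | tmul x y => exact h x y
  | add x y hx hy => rw [map_add, map_add, map_add, hx, hy]

theorem opTensor_mul (S S' : H →L[ℂ] H) (T T' : K →L[ℂ] K) :
    opTensor S T * opTensor S' T' = opTensor (S * S') (T * T') := by
  refine clm_ext fun x y => ?_
  simp [opTensor_htmul]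

theorem opTensor_one : opTensor (1 : H →L[ℂ] H) (1 : K →L[ℂ] K) = 1 := by
  refine clm_ext fun x y => ?_
  simp [opTensor_htmul]

theorem opTensor_star [CompleteSpace H] [CompleteSpace K] (S : H →L[ℂ] H) (T : K →L[ℂ] K) :
    star (opTensor S T) = opTensor (star S) (star T) := by
  symm
  rw [ContinuousLinearMap.star_eq_adjoint]
  refine (ContinuousLinearMap.eq_adjoint_iff _ _).mpr fun x y => ?_
  refine isClosed_property2
    (p := fun x y => ⟪opTensor (star S) (star T) x, y⟫_ℂ = ⟪x, opTensor S T y⟫_ℂ)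
    HilbertTensor.denseRange_of ?_ (fun x y => ?_) x y
  · apply isClosed_eq <;> fun_prop
  · rw [opTensor_of, opTensor_of, LinearIsometry.inner_map_map, LinearIsometry.inner_map_map]
    induction x using TensorProduct.induction_on with
    | zero => simp
    | add a b ha hb => rw [map_add, inner_add_left, inner_add_left, ha, hb]
    | tmul a b =>
      induction y using TensorProduct.induction_on with
      | zero => simp
      | add c d hc hd => rw [map_add, inner_add_right, inner_add_right, hc, hd]
      | tmul c d =>
        simp [ContinuousLinearMap.star_eq_adjoint, ContinuousLinearMap.adjoint_inner_left]

theorem htmul_add_left (x x' : H) (y : K) : htmul (x + x') y = htmul x y + htmul x' y := by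
  simp [htmul, TensorProduct.add_tmul]

theorem htmul_add_right (x : H) (y y' : K) : htmul x (y + y') = htmul x y + htmul x y' := by
  simp [htmul, TensorProduct.tmul_add]

theorem htmul_smul_left (c : ℂ) (x : H) (y : K) : htmul (c • x) y = c • htmul x y := by
  simp [htmul, ← TensorProduct.smul_tmul']

theorem htmul_smul_right (c : ℂ) (x : H) (y : K) : htmul x (c • y) = c • htmul x y := by
  simp [htmul]

/-- `S ↦ S ⊗ 1`. -/
def opTensorLeft : (H →L[ℂ] H) →ₐ[ℂ] (HilbertTensor H K →L[ℂ] HilbertTensor H K) :=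
  AlgHom.ofLinearMap
    { toFun := fun S => opTensor S 1
      map_add' := fun S T => clm_ext fun x y => by
        simp [opTensor_htmul, htmul_add_left]
      map_smul' := fun c S => clm_ext fun x y => by
        simp [opTensor_htmul, htmul_smul_left] }
    opTensor_one (fun S T => by simp [opTensor_mul])

/-- `T ↦ 1 ⊗ T`. -/
def opTensorRight : (K →L[ℂ] K) →ₐ[ℂ] (HilbertTensor H K →L[ℂ] HilbertTensor H K) :=
  AlgHom.ofLinearMap
    { toFun := fun T => opTensor 1 T
      map_add' := fun S T => clm_ext fun x y => by
        simp [opTensor_htmul, htmul_add_right]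
      map_smul' := fun c S => clm_ext fun x y => by
        simp [opTensor_htmul, htmul_smul_right] }
    opTensor_one (fun S T => by simp [opTensor_mul])

end Operators

/-- A (unital) representation of a unital C⋆-algebra on a Hilbert space. -/
structure HilbertRep (A : Type u) [CStarAlgebra A] : Type (u + 1) where
  /-- the Hilbert space -/
  space : Type u
  [instNACG : NormedAddCommGroup space]
  [instIPS : InnerProductSpace ℂ space]
  [instComplete : CompleteSpace space]
  /-- the action -/
  hom : A →⋆ₐ[ℂ] (space →L[ℂ] space)

attribute [instance] HilbertRep.instNACG HilbertRep.instIPS HilbertRep.instComplete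

variable {A B C D : Type u} [CStarAlgebra A] [CStarAlgebra B] [CStarAlgebra C] [CStarAlgebra D]

/-- The algebra homomorphism underlying `algRep`. -/
def algRepAux (π : HilbertRep A) (ρ : HilbertRep B) : A ⊗[ℂ] B →ₐ[ℂ]
    (HilbertTensor π.space ρ.space →L[ℂ] HilbertTensor π.space ρ.space) :=
  Algebra.TensorProduct.lift (opTensorLeft.comp π.hom.toAlgHom)
    (opTensorRight.comp ρ.hom.toAlgHom) (fun a b => by
      change opTensor _ _ * opTensor _ _ = opTensor _ _ * opTensor _ _
      simp [opTensor_mul])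

theorem algRepAux_tmul (π : HilbertRep A) (ρ : HilbertRep B) (a : A) (b : B) :
    algRepAux π ρ (a ⊗ₜ b) = opTensor (π.hom a) (ρ.hom b) := by
  rw [algRepAux, Algebra.TensorProduct.lift_tmul]
  change opTensor (π.hom a) 1 * opTensor 1 (ρ.hom b) = _
  simp [opTensor_mul]

theorem algRepAux_star (π : HilbertRep A) (ρ : HilbertRep B) (x : A ⊗[ℂ] B) :
    algRepAux π ρ (star x) = star (algRepAux π ρ x) := by
  induction x using TensorProduct.induction_on with
  | zero => simp
  | add a b ha hb => rw [star_add, map_add, map_add, star_add, ha, hb]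
  | tmul a b =>
    rw [TensorProduct.star_tmul, algRepAux_tmul, algRepAux_tmul, opTensor_star, map_star, map_star]

/-- The representation `π ⊗ ρ` of the algebraic tensor product on the Hilbert space tensor
product. -/
def algRep (π : HilbertRep A) (ρ : HilbertRep B) : A ⊗[ℂ] B →⋆ₐ[ℂ]
    (HilbertTensor π.space ρ.space →L[ℂ] HilbertTensor π.space ρ.space) where
  toAlgHom := algRepAux π ρ
  map_star' := algRepAux_star π ρ

theorem algRep_tmul (π : HilbertRep A) (ρ : HilbertRep B) (a : A) (b : B) :
    algRep π ρ (a ⊗ₜ b) = opTensor (π.hom a) (ρ.hom b) :=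
  algRepAux_tmul π ρ a b

instance : Inhabited (HilbertRep A) :=
  ⟨{ space := PUnit
     hom := { toFun := 0, map_zero' := rfl, map_add' := by simp, map_mul' := by simp
              map_one' := Subsingleton.elim _ _, commutes' := fun _ => Subsingleton.elim _ _
              map_star' := fun _ => Subsingleton.elim _ _ } }⟩

/-- The spatial (minimal) norm on the algebraic tensor product: the supremum of the norms
`‖(π ⊗ ρ)(x)‖` over all pairs of Hilbert space representations. -/
def spatialNorm (x : A ⊗[ℂ] B) : ℝ :=
  ⨆ p : HilbertRep A × HilbertRep B, ‖algRep p.1 p.2 x‖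

theorem bddAbove_algRep (x : A ⊗[ℂ] B) :
    BddAbove (Set.range fun p : HilbertRep A × HilbertRep B => ‖algRep p.1 p.2 x‖) := by
  induction x using TensorProduct.induction_on with
  | zero => exact ⟨0, by rintro _ ⟨p, rfl⟩; simp⟩
  | add x y hx hy =>
    obtain ⟨M, hM⟩ := hx
    obtain ⟨N, hN⟩ := hy
    refine ⟨M + N, ?_⟩
    rintro _ ⟨p, rfl⟩
    simp only [map_add]
    exact (norm_add_le _ _).trans (add_le_add (hM ⟨p, rfl⟩) (hN ⟨p, rfl⟩))
  | tmul a b =>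
    refine ⟨‖a‖ * ‖b‖, ?_⟩
    rintro _ ⟨p, rfl⟩
    have h1 : algRep p.1 p.2 (a ⊗ₜ[ℂ] b) = algRep p.1 p.2 (a ⊗ₜ[ℂ] 1) * algRep p.1 p.2 (1 ⊗ₜ b) := by
      rw [← map_mul]; simp
    have h2 : ‖algRep p.1 p.2 (a ⊗ₜ[ℂ] 1)‖ ≤ ‖a‖ :=
      NonUnitalStarAlgHom.norm_apply_le ((algRep p.1 p.2 : A ⊗[ℂ] B →⋆ₐ[ℂ] _).comp
        ({ Algebra.TensorProduct.includeLeft with map_star' := fun a => by simp } :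
          A →⋆ₐ[ℂ] A ⊗[ℂ] B)) a
    have h3 : ‖algRep p.1 p.2 ((1 : A) ⊗ₜ[ℂ] b)‖ ≤ ‖b‖ :=
      NonUnitalStarAlgHom.norm_apply_le ((algRep p.1 p.2 : A ⊗[ℂ] B →⋆ₐ[ℂ] _).comp
        ({ Algebra.TensorProduct.includeRight with map_star' := fun a => by simp } :
          B →⋆ₐ[ℂ] A ⊗[ℂ] B)) b
    simp only [h1]
    exact (norm_mul_le _ _).trans (mul_le_mul h2 h3 (norm_nonneg _) (norm_nonneg _))

theorem norm_algRep_le (π : HilbertRep A) (ρ : HilbertRep B) (x : A ⊗[ℂ] B) :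
    ‖algRep π ρ x‖ ≤ spatialNorm x :=
  le_ciSup (bddAbove_algRep x) (π, ρ)

theorem spatialNorm_le {x : A ⊗[ℂ] B} {M : ℝ}
    (h : ∀ (π : HilbertRep A) (ρ : HilbertRep B), ‖algRep π ρ x‖ ≤ M) : spatialNorm x ≤ M :=
  ciSup_le fun p => h p.1 p.2

theorem spatialNorm_nonneg (x : A ⊗[ℂ] B) : 0 ≤ spatialNorm x :=
  (norm_nonneg _).trans (norm_algRep_le default default x)

theorem spatialNorm_star (x : A ⊗[ℂ] B) : spatialNorm (star x) = spatialNorm x := by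
  simp [spatialNorm, map_star]

theorem spatialNorm_mul_self_le (x : A ⊗[ℂ] B) :
    spatialNorm x * spatialNorm x ≤ spatialNorm (star x * x) := by
  have h : spatialNorm x ≤ Real.sqrt (spatialNorm (star x * x)) := spatialNorm_le fun π ρ => by
    refine Real.le_sqrt_of_sq_le ?_
    have := norm_algRep_le π ρ (star x * x)
    rwa [map_mul, map_star, CStarRing.norm_star_mul_self, ← sq] at this
  calc spatialNorm x * spatialNorm x
      ≤ Real.sqrt (spatialNorm (star x * x)) * Real.sqrt (spatialNorm (star x * x)) :=
        mul_self_le_mul_self (spatialNorm_nonneg _) h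
    _ = _ := Real.mul_self_sqrt (spatialNorm_nonneg _)

/-- The spatial norm as a ring seminorm. -/
def spatialSeminorm (A B : Type u) [CStarAlgebra A] [CStarAlgebra B] :
    RingSeminorm (A ⊗[ℂ] B) where
  toFun := spatialNorm
  map_zero' := le_antisymm (spatialNorm_le fun π ρ => by simp) (spatialNorm_nonneg _)
  add_le' x y := spatialNorm_le fun π ρ => by
    rw [map_add]
    exact (norm_add_le _ _).trans (add_le_add (norm_algRep_le π ρ x) (norm_algRep_le π ρ y))
  neg' x := by simp [spatialNorm]
  mul_le' x y := spatialNorm_le fun π ρ => by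
    rw [map_mul]
    exact (norm_mul_le _ _).trans (mul_le_mul (norm_algRep_le π ρ x) (norm_algRep_le π ρ y)
      (norm_nonneg _) (spatialNorm_nonneg _))

/-- The algebraic tensor product, to be equipped with the spatial norm. -/
def AlgTensor (A B : Type u) [CStarAlgebra A] [CStarAlgebra B] : Type u := A ⊗[ℂ] B

instance : SeminormedRing (AlgTensor A B) := (spatialSeminorm A B).toSeminormedRing

instance : Algebra ℂ (AlgTensor A B) := inferInstanceAs (Algebra ℂ (A ⊗[ℂ] B))

theorem AlgTensor.norm_def (x : AlgTensor A B) : ‖x‖ = spatialNorm (x : A ⊗[ℂ] B) := rfl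

instance : NormedAlgebra ℂ (AlgTensor A B) where
  norm_smul_le c x := spatialNorm_le fun π ρ => by
    refine (congrArg norm (map_smul (algRep π ρ) c x)).le.trans ?_
    exact (norm_smul_le _ _).trans
      (mul_le_mul_of_nonneg_left (norm_algRep_le π ρ x) (norm_nonneg _))

instance : StarRing (AlgTensor A B) := inferInstanceAs (StarRing (A ⊗[ℂ] B))

instance : StarModule ℂ (AlgTensor A B) := inferInstanceAs (StarModule ℂ (A ⊗[ℂ] B))

theorem AlgTensor.norm_mul_self_le (x : AlgTensor A B) : ‖x‖ * ‖x‖ ≤ ‖star x * x‖ :=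
  spatialNorm_mul_self_le (x : A ⊗[ℂ] B)

theorem AlgTensor.norm_star (x : AlgTensor A B) : ‖star x‖ = ‖x‖ :=
  spatialNorm_star (x : A ⊗[ℂ] B)

instance : NormedStarGroup (AlgTensor A B) := ⟨fun x => (AlgTensor.norm_star x).le⟩

/-- The minimal (spatial) tensor product of two unital C⋆-algebras: the completion of the
algebraic tensor product for the spatial norm. -/
def MinTensor (A B : Type u) [CStarAlgebra A] [CStarAlgebra B] : Type u :=
  Completion (AlgTensor A B)

namespace MinTensor

instance : NormedRing (MinTensor A B) := inferInstanceAs (NormedRing (Completion (AlgTensor A B)))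

instance : CompleteSpace (MinTensor A B) :=
  inferInstanceAs (CompleteSpace (Completion (AlgTensor A B)))

instance : Algebra ℂ (MinTensor A B) :=
  inferInstanceAs (Algebra ℂ (Completion (AlgTensor A B)))

instance : NormedAlgebra ℂ (MinTensor A B) where
  norm_smul_le c x := norm_smul_le (α := ℂ) (β := Completion (AlgTensor A B)) c x

/-- The canonical map from the algebraic tensor product. -/
def ofRing : AlgTensor A B →+* MinTensor A B :=
  (Completion.coeRingHom : AlgTensor A B →+* Completion (AlgTensor A B))

theorem norm_ofRing (x : AlgTensor A B) : ‖ofRing x‖ = ‖x‖ :=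
  Completion.norm_coe (E := AlgTensor A B) x

theorem denseRange_ofRing : DenseRange (ofRing : AlgTensor A B → MinTensor A B) :=
  Completion.denseRange_coe (α := AlgTensor A B)

theorem ofRing_smul (c : ℂ) (x : AlgTensor A B) : ofRing (c • x) = c • ofRing x :=
  Completion.coe_smul (X := AlgTensor A B) c x

theorem continuous_ofRing : Continuous (ofRing : AlgTensor A B → MinTensor A B) :=
  Completion.continuous_coe (AlgTensor A B)

instance : Star (MinTensor A B) :=
  ⟨Completion.map (star : AlgTensor A B → AlgTensor A B)⟩

theorem continuous_starMap : Continuous (star : MinTensor A B → MinTensor A B) :=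
  Completion.continuous_map (α := AlgTensor A B)

theorem star_ofRing (x : AlgTensor A B) : star (ofRing x) = ofRing (star x) :=
  Completion.map_coe (starₗᵢ (E := AlgTensor A B) ℂ).isometry.uniformContinuous x

theorem induction {p : MinTensor A B → Prop} (hc : IsClosed {x | p x})
    (h : ∀ x : AlgTensor A B, p (ofRing x)) (x : MinTensor A B) : p x :=
  isClosed_property denseRange_ofRing hc h x

theorem induction₂ {p : MinTensor A B → MinTensor A B → Prop}
    (hc : IsClosed {x : MinTensor A B × MinTensor A B | p x.1 x.2})
    (h : ∀ x y : AlgTensor A B, p (ofRing x) (ofRing y)) (x y : MinTensor A B) : p x y :=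
  isClosed_property2 denseRange_ofRing hc h x y

instance : StarRing (MinTensor A B) where
  star_involutive x := by
    refine induction (p := fun x => star (star x) = x) ?_ (fun x => ?_) x
    · exact isClosed_eq (continuous_starMap.comp continuous_starMap) continuous_id
    · rw [star_ofRing, star_ofRing, star_star]
  star_mul x y := by
    refine induction₂ (p := fun x y => star (x * y) = star y * star x) ?_ (fun x y => ?_) x y
    · have := continuous_starMap (A := A) (B := B)
      apply isClosed_eq <;> fun_prop
    · rw [← map_mul, star_ofRing, star_ofRing, star_ofRing, star_mul, map_mul]
  star_add x y := by
    refine induction₂ (p := fun x y => star (x + y) = star x + star y) ?_ (fun x y => ?_) x y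
    · have := continuous_starMap (A := A) (B := B)
      apply isClosed_eq <;> fun_prop
    · rw [← map_add, star_ofRing, star_ofRing, star_ofRing, star_add, map_add]

instance : CStarAlgebra (MinTensor A B) where
  norm_mul_self_le x := by
    refine induction (p := fun x => ‖x‖ * ‖x‖ ≤ ‖star x * x‖) ?_ (fun x => ?_) x
    · have := continuous_starMap (A := A) (B := B)
      apply isClosed_le <;> fun_prop
    · rw [star_ofRing, ← map_mul, norm_ofRing, norm_ofRing]
      exact AlgTensor.norm_mul_self_le x
  star_smul c x := by
    refine induction (p := fun x => star (c • x) = star c • star x) ?_ (fun x => ?_) x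
    · exact isClosed_eq (continuous_starMap.comp (continuous_const_smul c))
        (continuous_starMap.const_smul (star c))
    · rw [← ofRing_smul, star_ofRing, star_ofRing, star_smul, ofRing_smul]

/-- The identity map, as a map onto the algebraic tensor product with the spatial norm. -/
def toAlg (A B : Type u) [CStarAlgebra A] [CStarAlgebra B] : A ⊗[ℂ] B →⋆ₐ[ℂ] AlgTensor A B where
  toFun x := x
  map_one' := rfl
  map_mul' _ _ := rfl
  map_zero' := rfl
  map_add' _ _ := rfl
  commutes' _ := rfl
  map_star' _ := rfl

/-- The canonical ⋆-homomorphism from the spatially normed algebraic tensor product. -/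
def ofAlg (A B : Type u) [CStarAlgebra A] [CStarAlgebra B] :
    AlgTensor A B →⋆ₐ[ℂ] MinTensor A B where
  __ := (ofRing : AlgTensor A B →+* MinTensor A B)
  commutes' _ := rfl
  map_star' x := (star_ofRing x).symm

/-- The canonical ⋆-homomorphism from the algebraic tensor product. -/
def of (A B : Type u) [CStarAlgebra A] [CStarAlgebra B] : A ⊗[ℂ] B →⋆ₐ[ℂ] MinTensor A B :=
  (ofAlg A B).comp (toAlg A B)

theorem norm_of (x : A ⊗[ℂ] B) : ‖of A B x‖ = spatialNorm x := norm_ofRing (toAlg A B x)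

theorem denseRange_of : DenseRange (of A B) := denseRange_ofRing (A := A) (B := B)

section Lift

variable {E : Type u} [CStarAlgebra E]

/-- Auxiliary ring homomorphism for `lift`. -/
def liftAlg (f : A ⊗[ℂ] B →⋆ₐ[ℂ] E) : AlgTensor A B →+* E where
  toFun x := f x
  map_one' := map_one f
  map_mul' := map_mul f
  map_zero' := map_zero f
  map_add' := map_add f

theorem continuous_liftAlg (f : A ⊗[ℂ] B →⋆ₐ[ℂ] E) (hf : ∀ x, ‖f x‖ ≤ spatialNorm x) :
    Continuous (liftAlg f) :=
  AddMonoidHomClass.continuous_of_bound (liftAlg f) 1 fun x => (hf x).trans_eq (one_mul _).symm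

/-- Auxiliary ring homomorphism for `lift`. -/
def liftRing (f : A ⊗[ℂ] B →⋆ₐ[ℂ] E) (hf : ∀ x, ‖f x‖ ≤ spatialNorm x) : MinTensor A B →+* E :=
  (Completion.extensionHom (liftAlg f) (continuous_liftAlg f hf) :
    Completion (AlgTensor A B) →+* E)

theorem liftRing_ofRing (f : A ⊗[ℂ] B →⋆ₐ[ℂ] E) (hf : ∀ x, ‖f x‖ ≤ spatialNorm x)
    (x : AlgTensor A B) : liftRing f hf (ofRing x) = liftAlg f x :=
  Completion.extensionHom_coe (liftAlg f) (continuous_liftAlg f hf) x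

theorem continuous_liftRing (f : A ⊗[ℂ] B →⋆ₐ[ℂ] E) (hf : ∀ x, ‖f x‖ ≤ spatialNorm x) :
    Continuous (liftRing f hf) :=
  Completion.continuous_extension (f := liftAlg f)

/-- A ⋆-homomorphism that is contractive for the spatial norm extends to the minimal tensor
product. -/
def lift (f : A ⊗[ℂ] B →⋆ₐ[ℂ] E) (hf : ∀ x, ‖f x‖ ≤ spatialNorm x) : MinTensor A B →⋆ₐ[ℂ] E where
  __ := liftRing f hf
  commutes' c := (liftRing_ofRing f hf (algebraMap ℂ (AlgTensor A B) c)).trans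
    (AlgHomClass.commutes f c)
  map_star' x := by
    refine induction (p := fun x => liftRing f hf (star x) = star (liftRing f hf x)) ?_
      (fun x => ?_) x
    · exact isClosed_eq ((continuous_liftRing f hf).comp continuous_starMap)
        (continuous_liftRing f hf).star
    · rw [star_ofRing, liftRing_ofRing, liftRing_ofRing]
      exact map_star f x

theorem lift_of (f : A ⊗[ℂ] B →⋆ₐ[ℂ] E) (hf : ∀ x, ‖f x‖ ≤ spatialNorm x) (x : A ⊗[ℂ] B) :
    lift f hf (of A B x) = f x :=
  liftRing_ofRing f hf (toAlg A B x)

end Lift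

end MinTensor

namespace MinTensor

/-- The elementary tensor `a ⊗ b` in the minimal tensor product. -/
def tmul (a : A) (b : B) : MinTensor A B := of A B (a ⊗ₜ[ℂ] b)

theorem continuous_hom {E : Type u} [CStarAlgebra E] (f : D →⋆ₐ[ℂ] E) : Continuous f :=
  AddMonoidHomClass.continuous_of_bound f 1 fun x =>
    (NonUnitalStarAlgHom.norm_apply_le f x).trans_eq (one_mul _).symm

/-- An additive closed property of elements of the minimal tensor product has to be checked on
elementary tensors only. -/
theorem induction_tmul {p : MinTensor A B → Prop} (hc : IsClosed {x | p x})
    (h0 : p 0) (ha : ∀ x y, p x → p y → p (x + y)) (ht : ∀ a b, p (tmul a b))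
    (x : MinTensor A B) : p x := by
  refine isClosed_property denseRange_of hc (fun x => ?_) x
  induction x using TensorProduct.induction_on with
  | zero => rwa [map_zero]
  | tmul a b => exact ht a b
  | add x y hx hy => rw [map_add]; exact ha _ _ hx hy

/-- The representation `π ⊗ ρ` of the minimal tensor product. -/
def rep (π : HilbertRep A) (ρ : HilbertRep B) : HilbertRep (MinTensor A B) where
  space := HilbertTensor π.space ρ.space
  hom := lift (algRep π ρ) (norm_algRep_le π ρ)

theorem rep_of (π : HilbertRep A) (ρ : HilbertRep B) (x : A ⊗[ℂ] B) :
    (rep π ρ).hom (of A B x) = algRep π ρ x :=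
  lift_of _ _ x

theorem rep_tmul (π : HilbertRep A) (ρ : HilbertRep B) (a : A) (b : B) :
    (rep π ρ).hom (tmul a b) = opTensor (π.hom a) (ρ.hom b) := by
  rw [tmul, rep_of, algRep_tmul]

theorem norm_le_of_rep {x : MinTensor A B} {M : ℝ}
    (h : ∀ (π : HilbertRep A) (ρ : HilbertRep B), ‖(rep π ρ).hom x‖ ≤ M) : ‖x‖ ≤ M := by
  refine le_of_forall_pos_le_add fun ε hε => ?_
  obtain ⟨y, hy⟩ := Metric.denseRange_iff.mp (denseRange_of (A := A) (B := B)) x (ε / 2)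
    (half_pos hε)
  rw [dist_eq_norm] at hy
  have h1 : ‖of A B y‖ ≤ M + ε / 2 := by
    rw [norm_of]
    refine spatialNorm_le fun π ρ => ?_
    rw [← rep_of]
    calc ‖(rep π ρ).hom (of A B y)‖ = ‖(rep π ρ).hom x - (rep π ρ).hom (x - of A B y)‖ := by
          rw [map_sub]; congr 1; abel
      _ ≤ ‖(rep π ρ).hom x‖ + ‖(rep π ρ).hom (x - of A B y)‖ := norm_sub_le _ _
      _ ≤ M + ε / 2 := add_le_add (h π ρ)
          ((NonUnitalStarAlgHom.norm_apply_le _ _).trans hy.le)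
  calc ‖x‖ = ‖of A B y + (x - of A B y)‖ := by congr 1; abel
    _ ≤ ‖of A B y‖ + ‖x - of A B y‖ := norm_add_le _ _
    _ ≤ M + ε := by linarith

end MinTensor

/-- The restriction of a representation along a ⋆-homomorphism. -/
def HilbertRep.comap (φ : A →⋆ₐ[ℂ] B) (π : HilbertRep B) : HilbertRep A where
  space := π.space
  hom := π.hom.comp φ

/-- The algebraic tensor product of two ⋆-homomorphisms. -/
def algMap (φ : A →⋆ₐ[ℂ] C) (ψ : B →⋆ₐ[ℂ] D) : A ⊗[ℂ] B →⋆ₐ[ℂ] C ⊗[ℂ] D where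
  toAlgHom := Algebra.TensorProduct.map φ.toAlgHom ψ.toAlgHom
  map_star' x := by
    change Algebra.TensorProduct.map φ.toAlgHom ψ.toAlgHom (star x) =
      star (Algebra.TensorProduct.map φ.toAlgHom ψ.toAlgHom x)
    induction x using TensorProduct.induction_on with
    | zero => simp
    | add a b ha hb => rw [star_add, map_add, map_add, star_add, ha, hb]
    | tmul a b => simp [map_star]

theorem algMap_tmul (φ : A →⋆ₐ[ℂ] C) (ψ : B →⋆ₐ[ℂ] D) (a : A) (b : B) :
    algMap φ ψ (a ⊗ₜ b) = φ a ⊗ₜ ψ b := rfl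

theorem algRep_algMap (φ : A →⋆ₐ[ℂ] C) (ψ : B →⋆ₐ[ℂ] D) (π : HilbertRep C) (ρ : HilbertRep D)
    (x : A ⊗[ℂ] B) : algRep π ρ (algMap φ ψ x) = algRep (π.comap φ) (ρ.comap ψ) x := by
  induction x using TensorProduct.induction_on with
  | zero => rw [map_zero, map_zero, map_zero]; rfl
  | add a b ha hb => rw [map_add, map_add, map_add, ha, hb]; rfl
  | tmul a b => rw [algMap_tmul, algRep_tmul, algRep_tmul]; rfl

/-- The tensor product `φ ⊗ ψ : A ⊗ B → C ⊗ D` of two ⋆-homomorphisms. -/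
def MinTensor.map (φ : A →⋆ₐ[ℂ] C) (ψ : B →⋆ₐ[ℂ] D) : MinTensor A B →⋆ₐ[ℂ] MinTensor C D :=
  MinTensor.lift ((MinTensor.of C D).comp (algMap φ ψ)) fun x => by
    rw [StarAlgHom.comp_apply, MinTensor.norm_of]
    refine spatialNorm_le fun π ρ => ?_
    rw [algRep_algMap]
    exact norm_algRep_le _ _ _

theorem MinTensor.map_tmul (φ : A →⋆ₐ[ℂ] C) (ψ : B →⋆ₐ[ℂ] D) (a : A) (b : B) :
    MinTensor.map φ ψ (MinTensor.tmul a b) = MinTensor.tmul (φ a) (ψ b) :=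
  MinTensor.lift_of _ _ _

section Gram

variable {X Y : Type*} [NormedAddCommGroup X] [InnerProductSpace ℂ X]
  [NormedAddCommGroup Y] [InnerProductSpace ℂ Y]

/-- Two operators with the same matrix coefficients with respect to two families of vectors with
the same Gram matrix, the second one total, compare in norm. -/
theorem norm_le_of_gram {ι : Type*} {u : ι → X} {v : ι → Y} (S : Y →L[ℂ] Y) (T : X →L[ℂ] X)
    (hv : Dense (Submodule.span ℂ (Set.range v) : Set Y))
    (h1 : ∀ i j, ⟪u i, u j⟫_ℂ = ⟪v i, v j⟫_ℂ)
    (h2 : ∀ i j, ⟪u i, T (u j)⟫_ℂ = ⟪v i, S (v j)⟫_ℂ) : ‖S‖ ≤ ‖T‖ := by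
  set U := Finsupp.linearCombination ℂ u with hU
  set V := Finsupp.linearCombination ℂ v with hV
  have key : ∀ (P : X →L[ℂ] X) (Q : Y →L[ℂ] Y),
      (∀ i j, ⟪u i, P (u j)⟫_ℂ = ⟪v i, Q (v j)⟫_ℂ) → ∀ c d, ⟪U c, P (U d)⟫_ℂ = ⟪V c, Q (V d)⟫_ℂ := by
    intro P Q h c d
    induction c using Finsupp.induction_linear with
    | zero => simp
    | add c c' hc hc' => rw [map_add, map_add, inner_add_left, inner_add_left, hc, hc']
    | single i a =>
      induction d using Finsupp.induction_linear with
      | zero => simp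
      | add d d' hd hd' => rw [map_add, map_add, map_add, map_add, inner_add_right,
          inner_add_right, hd, hd']
      | single j b => simp [hU, hV, h]
  have hn : ∀ c, ‖U c‖ = ‖V c‖ := fun c => by
    have := key (ContinuousLinearMap.id ℂ X) (ContinuousLinearMap.id ℂ Y) h1 c c
    simp only [ContinuousLinearMap.id_apply, inner_self_eq_norm_sq_to_K] at this
    have h' : ‖U c‖ ^ 2 = ‖V c‖ ^ 2 := by exact_mod_cast this
    exact (sq_eq_sq₀ (norm_nonneg _) (norm_nonneg _)).mp h'
  have hd : DenseRange V := by
    rw [DenseRange]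
    convert hv
    rw [hV, ← Finsupp.range_linearCombination]
    rfl
  have hb : ∀ y z : Y, ‖⟪y, S z⟫_ℂ‖ ≤ ‖T‖ * ‖y‖ * ‖z‖ := by
    refine isClosed_property2 hd ?_ fun c d => ?_
    · apply isClosed_le <;> fun_prop
    · rw [← key T S h2, ← hn, ← hn]
      calc ‖⟪U c, T (U d)⟫_ℂ‖ ≤ ‖U c‖ * ‖T (U d)‖ := norm_inner_le_norm _ _
        _ ≤ ‖U c‖ * (‖T‖ * ‖U d‖) := by gcongr; exact T.le_opNorm _
        _ = _ := by ring
  refine S.opNorm_le_bound (norm_nonneg _) fun z => ?_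
  by_cases hz : ‖S z‖ = 0
  · rw [hz]; positivity
  · have := hb (S z) z
    rw [inner_self_eq_norm_sq_to_K] at this
    have h3 : ‖S z‖ * ‖S z‖ ≤ ‖S z‖ * (‖T‖ * ‖z‖) := by
      calc _ = ‖((‖S z‖ : ℂ)) ^ 2‖ := by simp [sq]
        _ ≤ _ := this
        _ = _ := by ring
    exact le_of_mul_le_mul_left h3 (lt_of_le_of_ne (norm_nonneg _) (Ne.symm hz))

end Gram

theorem dense_span_htmul (H K : Type u) [NormedAddCommGroup H] [InnerProductSpace ℂ H]
    [NormedAddCommGroup K] [InnerProductSpace ℂ K] :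
    Dense (Submodule.span ℂ (Set.range fun p : H × K => htmul p.1 p.2) :
      Set (HilbertTensor H K)) := by
  refine HilbertTensor.denseRange_of.mono ?_
  rintro _ ⟨x, rfl⟩
  induction x using TensorProduct.induction_on with
  | zero => rw [map_zero]; exact Submodule.zero_mem _
  | add a b ha hb => rw [map_add]; exact Submodule.add_mem _ ha hb
  | tmul a b => exact Submodule.subset_span ⟨(a, b), rfl⟩

/-- The algebraic flip. -/
def algComm (A B : Type u) [CStarAlgebra A] [CStarAlgebra B] : A ⊗[ℂ] B →⋆ₐ[ℂ] B ⊗[ℂ] A where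
  toAlgHom := (Algebra.TensorProduct.comm ℂ A B : A ⊗[ℂ] B →ₐ[ℂ] B ⊗[ℂ] A)
  map_star' x := by
    change Algebra.TensorProduct.comm ℂ A B (star x) = star (Algebra.TensorProduct.comm ℂ A B x)
    induction x using TensorProduct.induction_on with
    | zero => simp
    | add a b ha hb => rw [star_add, map_add, map_add, star_add, ha, hb]
    | tmul a b => simp

theorem algComm_tmul (a : A) (b : B) : algComm A B (a ⊗ₜ b) = b ⊗ₜ a := rfl

theorem norm_algRep_algComm (π : HilbertRep B) (ρ : HilbertRep A) (x : A ⊗[ℂ] B) :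
    ‖algRep π ρ (algComm A B x)‖ ≤ ‖algRep ρ π x‖ := by
  refine norm_le_of_gram (u := fun p : π.space × ρ.space => htmul p.2 p.1)
    (v := fun p : π.space × ρ.space => htmul p.1 p.2) _ _ (dense_span_htmul _ _) ?_ ?_
  · intro i j
    simp only [inner_htmul]
    ring
  · intro i j
    induction x using TensorProduct.induction_on with
    | zero => simp
    | add a b ha hb =>
      simp only [map_add, add_apply, inner_add_right] at ha hb ⊢
      rw [ha, hb]
    | tmul a b =>
      simp only [algComm_tmul, algRep_tmul, opTensor_htmul, inner_htmul]
      ring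

/-- The flip `A ⊗ B → B ⊗ A`, `a ⊗ b ↦ b ⊗ a`. -/
def MinTensor.flip (A B : Type u) [CStarAlgebra A] [CStarAlgebra B] :
    MinTensor A B →⋆ₐ[ℂ] MinTensor B A :=
  MinTensor.lift ((MinTensor.of B A).comp (algComm A B)) fun x => by
    rw [StarAlgHom.comp_apply, MinTensor.norm_of]
    exact spatialNorm_le fun π ρ => (norm_algRep_algComm π ρ x).trans (norm_algRep_le _ _ _)

theorem MinTensor.flip_tmul (a : A) (b : B) :
    MinTensor.flip A B (MinTensor.tmul a b) = MinTensor.tmul b a :=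
  MinTensor.lift_of _ _ _

section Domination

/-- The action of a matrix over `D` on tuples of vectors. -/
def matAct {ι : Type*} [Fintype ι] (ρ : HilbertRep D) (Y : CStarMatrix ι ι D)
    (k : ι → ρ.space) (j : ι) : ρ.space :=
  ∑ l, ρ.hom (Y j l) (k l)

theorem matAct_mul {ι : Type*} [Fintype ι] (ρ : HilbertRep D) (P Q : CStarMatrix ι ι D)
    (k : ι → ρ.space) : matAct ρ (P * Q) k = matAct ρ P (matAct ρ Q k) := by
  funext j
  simp only [matAct, CStarMatrix.mul_apply, map_sum, map_mul, sum_apply,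
    mul_apply_eq_comp]
  rw [Finset.sum_comm]

theorem inner_matAct_star {ι : Type*} [Fintype ι] (ρ : HilbertRep D) (P : CStarMatrix ι ι D)
    (k k' : ι → ρ.space) :
    ∑ j, ⟪k j, matAct ρ (star P) k' j⟫_ℂ = ∑ j, ⟪matAct ρ P k j, k' j⟫_ℂ := by
  simp only [matAct, CStarMatrix.star_apply, inner_sum, sum_inner, map_star,
    ContinuousLinearMap.star_eq_adjoint, ContinuousLinearMap.adjoint_inner_right]
  rw [Finset.sum_comm]

theorem inner_matAct_star_mul_self {ι : Type*} [Fintype ι] (ρ : HilbertRep D)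
    (P : CStarMatrix ι ι D) (k : ι → ρ.space) :
    ∑ j, ⟪k j, matAct ρ (star P * P) k j⟫_ℂ = ((∑ j, ‖matAct ρ P k j‖ ^ 2 : ℝ) : ℂ) := by
  rw [matAct_mul, inner_matAct_star]
  simp [inner_self_eq_norm_sq_to_K]

theorem exists_pos_neg_parts {E : Type*} [CStarAlgebra E] (Y : E) (hY : star Y = Y) :
    ∃ P S : E, star P = P ∧ star S = S ∧ P * P - S * S = Y ∧ P * P * (S * S) = 0 := by
  let _ := CStarAlgebra.spectralOrder E
  let _ := CStarAlgebra.spectralOrderedRing E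
  obtain ⟨S, hS, hSS⟩ := CStarAlgebra.nonneg_iff_exists_isSelfAdjoint_and_eq_mul_self.mp
    (CFC.negPart_nonneg Y)
  obtain ⟨P, hP, hPP⟩ := CStarAlgebra.nonneg_iff_exists_isSelfAdjoint_and_eq_mul_self.mp
    (CFC.posPart_nonneg Y)
  refine ⟨P, S, hP, hS, ?_, ?_⟩
  · rw [← hPP, ← hSS]
    exact CFC.posPart_sub_negPart Y hY
  · rw [← hPP, ← hSS]
    exact CFC.posPart_mul_negPart Y

/-- A self-adjoint matrix over `D` that is positive in a jointly faithful family of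
representations is of the form `W⋆ W`. -/
theorem exists_eq_star_mul_self {ι : Type*} [Fintype ι] {I : Type*} (ρ : I → HilbertRep D)
    (hρ : ∀ d : D, (∀ i, (ρ i).hom d = 0) → d = 0) (Y : CStarMatrix ι ι D) (hY : star Y = Y)
    (hpos : ∀ i (k : ι → (ρ i).space), 0 ≤ (∑ j, ⟪k j, matAct (ρ i) Y k j⟫_ℂ).re) :
    ∃ W : CStarMatrix ι ι D, Y = star W * W := by
  classical
  let _ := CStarAlgebra.spectralOrder D
  let _ := CStarAlgebra.spectralOrderedRing D
  obtain ⟨P, S, hP, hS, hsub, hmul⟩ := exists_pos_neg_parts Y hY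
  obtain ⟨Z, hZdef⟩ : ∃ Z, Z = S * S := ⟨_, rfl⟩
  rw [← hZdef] at hsub hmul
  have hZ : star Z = Z := by rw [hZdef, star_mul, hS]
  have hV : S * Z = 0 := by
    ext j l
    refine hρ _ fun i => ?_
    have h0 : ∀ k : ι → (ρ i).space, matAct (ρ i) (S * Z) k j = 0 := by
      intro k
      have e1 : star (S * Z) * (S * Z) = - (star Z * (Y * Z)) := by
        have : Y * Z = - (Z * Z) := by
          nth_rewrite 1 [← hsub]
          rw [sub_mul, hmul, zero_sub]
        rw [this, star_mul, hS, mul_assoc, ← mul_assoc S S, ← hZdef]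
        simp
      have e2 := inner_matAct_star_mul_self (ρ i) (S * Z) k
      have e3 := hpos i (matAct (ρ i) Z k)
      have e4 : ∑ j, ⟪k j, matAct (ρ i) (star (S * Z) * (S * Z)) k j⟫_ℂ =
          - ∑ j, ⟪matAct (ρ i) Z k j, matAct (ρ i) Y (matAct (ρ i) Z k) j⟫_ℂ := by
        rw [e1, ← inner_matAct_star, ← matAct_mul, ← matAct_mul, ← mul_assoc]
        rw [← Finset.sum_neg_distrib]
        refine Finset.sum_congr rfl fun j _ => ?_
        simp [matAct, inner_sum, mul_assoc]
      rw [e2] at e4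
      have e5 : ∑ j, ‖matAct (ρ i) (S * Z) k j‖ ^ 2 ≤ 0 := by
        have := congrArg Complex.re e4
        rw [Complex.ofReal_re, Complex.neg_re] at this
        linarith
      have e6 := (Finset.sum_eq_zero_iff_of_nonneg (fun j _ => by positivity)).mp
        (le_antisymm e5 (Finset.sum_nonneg fun j _ => by positivity)) j (Finset.mem_univ j)
      simpa using e6
    ext x
    have := h0 (Pi.single l x)
    rw [matAct, Finset.sum_eq_single l] at this
    · simpa using this
    · intro b _ hb
      simp [Pi.single_eq_of_ne hb]
    · simp
  have hZ0 : Z = 0 := by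
    have h1 : Z * Z = 0 := by
      nth_rewrite 1 [hZdef]
      rw [mul_assoc, hV, mul_zero]
    have h2 : star Z * Z = 0 := by rw [hZ, h1]
    exact CStarRing.star_mul_self_eq_zero_iff Z |>.mp h2
  refine ⟨P, ?_⟩
  rw [hP, ← hsub, hZ0, sub_zero]

/-- The slice `a ⊗ d ↦ ⟪h, π(a) h'⟫ d`. -/
def vecSlice (π : HilbertRep A) (h h' : π.space) : A ⊗[ℂ] D →ₗ[ℂ] D :=
  TensorProduct.lift
    { toFun := fun a => ⟪h, π.hom a h'⟫_ℂ • LinearMap.id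
      map_add' := fun a b => by simp [add_smul]
      map_smul' := fun c a => by simp [mul_smul] }

theorem vecSlice_tmul (π : HilbertRep A) (h h' : π.space) (a : A) (d : D) :
    vecSlice π h h' (a ⊗ₜ d) = ⟪h, π.hom a h'⟫_ℂ • d := rfl

theorem star_vecSlice (π : HilbertRep A) (h h' : π.space) (x : A ⊗[ℂ] D) :
    star (vecSlice π h h' x) = vecSlice π h' h (star x) := by
  induction x using TensorProduct.induction_on with
  | zero => simp
  | add a b ha hb => rw [map_add, star_add, star_add, map_add, ha, hb]
  | tmul a d =>
    rw [TensorProduct.star_tmul, vecSlice_tmul, vecSlice_tmul, star_smul, map_star,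
      ContinuousLinearMap.star_eq_adjoint, ContinuousLinearMap.adjoint_inner_right,
      ← starRingEnd_apply, inner_conj_symm]

theorem inner_algRep (π : HilbertRep A) (σ : HilbertRep D) (x : A ⊗[ℂ] D) (h h' : π.space)
    (k k' : σ.space) : ⟪htmul h k, algRep π σ x (htmul h' k')⟫_ℂ =
      ⟪k, σ.hom (vecSlice π h h' x) k'⟫_ℂ := by
  induction x using TensorProduct.induction_on with
  | zero => simp
  | add a b ha hb => simp only [map_add, add_apply, inner_add_right, ha, hb]
  | tmul a d =>
    rw [algRep_tmul, opTensor_htmul, inner_htmul, vecSlice_tmul, map_smul, smul_apply,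
      inner_smul_right]

theorem re_inner_algRep (π : HilbertRep A) (σ : HilbertRep D) (x : A ⊗[ℂ] D) (M : ℝ)
    (ξ : HilbertTensor π.space σ.space) :
    (⟪ξ, algRep π σ ((M ^ 2 : ℂ) • 1 - star x * x) ξ⟫_ℂ).re =
      M ^ 2 * ‖ξ‖ ^ 2 - ‖algRep π σ x ξ‖ ^ 2 := by
  rw [map_sub, map_smul, map_one, map_mul, map_star, sub_apply, inner_sub_right, smul_apply,
    mul_apply_eq_comp, ContinuousLinearMap.star_eq_adjoint,
    ContinuousLinearMap.adjoint_inner_right, inner_self_eq_norm_sq_to_K, inner_smul_right,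
    one_apply_eq_self, inner_self_eq_norm_sq_to_K, Complex.sub_re]
  norm_cast
  simp only [← Complex.ofReal_mul, Complex.coe_algebraMap, Complex.ofReal_re]

/-- The norm of `(π ⊗ σ)(x)` is dominated by the norms of `(π ⊗ ρᵢ)(x)` for a jointly faithful
family `ρᵢ`. -/
theorem norm_algRep_le_of_faithful {I : Type*} (π : HilbertRep A) (ρ : I → HilbertRep D)
    (hρ : ∀ d : D, (∀ i, (ρ i).hom d = 0) → d = 0) (σ : HilbertRep D) (x : A ⊗[ℂ] D) {M : ℝ}
    (hM : 0 ≤ M) (h : ∀ i, ‖algRep π (ρ i) x‖ ≤ M) : ‖algRep π σ x‖ ≤ M := by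
  have main : ∀ z : π.space ⊗[ℂ] σ.space,
      ‖algRep π σ x (HilbertTensor.of _ _ z)‖ ≤ M * ‖HilbertTensor.of _ _ z‖ := by
    intro z
    obtain ⟨s, hs⟩ := TensorProduct.exists_finset z
    set y : A ⊗[ℂ] D := (M ^ 2 : ℂ) • 1 - star x * x with hy
    let Y : CStarMatrix s s D := CStarMatrix.ofMatrix fun j l => vecSlice π j.1.1 l.1.1 y
    have hysa : star y = y := by
      rw [hy]
      simp
    have hY : star Y = Y := by
      ext j l
      rw [CStarMatrix.star_apply]
      change star (vecSlice π _ _ y) = vecSlice π _ _ y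
      rw [star_vecSlice, hysa]
    have quad : ∀ (τ : HilbertRep D) (k : s → τ.space),
        ∑ j, ⟪k j, matAct τ Y k j⟫_ℂ =
          ⟪∑ j : s, htmul j.1.1 (k j), algRep π τ y (∑ j : s, htmul j.1.1 (k j))⟫_ℂ := by
      intro τ k
      rw [map_sum, sum_inner]
      simp only [matAct, inner_sum, inner_algRep]
      rfl
    obtain ⟨W, hW⟩ := exists_eq_star_mul_self ρ hρ Y hY fun i k => by
      rw [quad, re_inner_algRep, sub_nonneg, ← mul_pow]
      have := ((algRep π (ρ i) x).le_opNorm (∑ j : s, htmul j.1.1 (k j))).trans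
        (mul_le_mul_of_nonneg_right (h i) (norm_nonneg _))
      gcongr
    have hz : HilbertTensor.of _ _ z = ∑ j : s, htmul j.1.1 j.1.2 := by
      rw [hs, map_sum, ← Finset.sum_coe_sort]
      rfl
    have h1 := quad σ fun j => j.1.2
    rw [hW, inner_matAct_star_mul_self, ← hz] at h1
    have h2 := congrArg Complex.re h1
    rw [re_inner_algRep, Complex.ofReal_re] at h2
    have h3 : 0 ≤ M ^ 2 * ‖HilbertTensor.of _ _ z‖ ^ 2 -
        ‖algRep π σ x (HilbertTensor.of _ _ z)‖ ^ 2 := by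
      rw [← h2]
      positivity
    rw [sub_nonneg, ← mul_pow] at h3
    exact (sq_le_sq₀ (norm_nonneg _) (by positivity)).mp h3
  refine ContinuousLinearMap.opNorm_le_bound _ hM fun ξ => ?_
  refine isClosed_property (p := fun ξ => ‖algRep π σ x ξ‖ ≤ M * ‖ξ‖)
    HilbertTensor.denseRange_of ?_ main ξ
  apply isClosed_le <;> fun_prop

end Domination

namespace MinTensor

/-- `a ↦ a ⊗ 1`. -/
def inclLeft (A B : Type u) [CStarAlgebra A] [CStarAlgebra B] : A →⋆ₐ[ℂ] MinTensor A B :=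
  (of A B).comp { Algebra.TensorProduct.includeLeft with map_star' := fun a => by simp }

/-- `b ↦ 1 ⊗ b`. -/
def inclRight (A B : Type u) [CStarAlgebra A] [CStarAlgebra B] : B →⋆ₐ[ℂ] MinTensor A B :=
  (of A B).comp { Algebra.TensorProduct.includeRight with map_star' := fun a => by simp }

theorem inclLeft_apply (a : A) : inclLeft A B a = tmul a 1 := rfl

theorem inclRight_apply (b : B) : inclRight A B b = tmul 1 b := rfl

theorem tmul_mul_tmul (a a' : A) (b b' : B) :
    (tmul a b : MinTensor A B) * tmul a' b' = tmul (a * a') (b * b') := by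
  rw [tmul, tmul, ← map_mul, Algebra.TensorProduct.tmul_mul_tmul, tmul]

theorem star_tmul (a : A) (b : B) : star (tmul a b : MinTensor A B) = tmul (star a) (star b) := by
  rw [tmul, ← map_star, TensorProduct.star_tmul, tmul]

theorem commute_algAssoc (d : MinTensor A B) (c : C) :
    Commute (map (.id ℂ A) (inclLeft B C) d) (tmul (1 : A) (tmul (1 : B) c)) := by
  refine induction_tmul (p := fun d => map (.id ℂ A) (inclLeft B C) d *
    tmul (1 : A) (tmul (1 : B) c) = tmul (1 : A) (tmul (1 : B) c) *
      map (.id ℂ A) (inclLeft B C) d) ?_ ?_ ?_ ?_ d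
  · have := continuous_hom (map (.id ℂ A) (inclLeft B C))
    apply isClosed_eq <;> fun_prop
  · simp
  · intro x y hx hy
    rw [map_add, add_mul, mul_add, hx, hy]
  · intro a b
    rw [map_tmul, inclLeft_apply, tmul_mul_tmul, tmul_mul_tmul, tmul_mul_tmul, tmul_mul_tmul]
    simp

/-- The algebra homomorphism underlying `algAssoc`. -/
def algAssocAux (A B C : Type u) [CStarAlgebra A] [CStarAlgebra B] [CStarAlgebra C] :
    MinTensor A B ⊗[ℂ] C →ₐ[ℂ] MinTensor A (MinTensor B C) :=
  Algebra.TensorProduct.lift (map (.id ℂ A) (inclLeft B C)).toAlgHom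
    ((inclRight A (MinTensor B C)).comp (inclRight B C)).toAlgHom commute_algAssoc

theorem algAssocAux_tmul (d : MinTensor A B) (c : C) : algAssocAux A B C (d ⊗ₜ c) =
    map (.id ℂ A) (inclLeft B C) d * tmul (1 : A) (tmul (1 : B) c) := rfl

/-- The ⋆-homomorphism `(a ⊗ b) ⊗ c ↦ a ⊗ (b ⊗ c)` on the algebraic tensor product of `A ⊗ B`
and `C`. -/
def algAssoc (A B C : Type u) [CStarAlgebra A] [CStarAlgebra B] [CStarAlgebra C] :
    MinTensor A B ⊗[ℂ] C →⋆ₐ[ℂ] MinTensor A (MinTensor B C) where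
  toAlgHom := algAssocAux A B C
  map_star' x := by
    change algAssocAux A B C (star x) = star (algAssocAux A B C x)
    induction x using TensorProduct.induction_on with
    | zero => simp
    | add a b ha hb => rw [star_add, map_add, map_add, star_add, ha, hb]
    | tmul d c =>
      rw [TensorProduct.star_tmul, algAssocAux_tmul, algAssocAux_tmul, star_mul,
        commute_algAssoc, map_star, star_tmul, star_tmul, star_one, star_one]

theorem algAssoc_tmul (d : MinTensor A B) (c : C) : algAssoc A B C (d ⊗ₜ c) =
    map (.id ℂ A) (inclLeft B C) d * tmul (1 : A) (tmul (1 : B) c) := rfl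

theorem algAssoc_tmul_tmul (a : A) (b : B) (c : C) :
    algAssoc A B C (tmul a b ⊗ₜ c) = tmul a (tmul b c) := by
  rw [algAssoc_tmul, map_tmul, inclLeft_apply, tmul_mul_tmul, tmul_mul_tmul]
  simp

theorem dense_span_htmul₃ (H K L : Type u) [NormedAddCommGroup H] [InnerProductSpace ℂ H]
    [NormedAddCommGroup K] [InnerProductSpace ℂ K] [NormedAddCommGroup L]
    [InnerProductSpace ℂ L] :
    Dense (Submodule.span ℂ (Set.range fun p : H × K × L => htmul p.1 (htmul p.2.1 p.2.2)) :
      Set (HilbertTensor H (HilbertTensor K L))) := by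
  set N := Submodule.span ℂ (Set.range fun p : H × K × L => htmul p.1 (htmul p.2.1 p.2.2)) with hN
  have key : ∀ (x : H) (z : HilbertTensor K L), htmul x z ∈ N.topologicalClosure := by
    intro x z
    let f : HilbertTensor K L →ₗ[ℂ] HilbertTensor H (HilbertTensor K L) :=
      { toFun := htmul x
        map_add' := htmul_add_right x
        map_smul' := fun c z => htmul_smul_right c x z }
    have hf : Continuous f := AddMonoidHomClass.continuous_of_bound f ‖x‖ fun z => by
      change ‖htmul x z‖ ≤ _
      simp [htmul]
    refine (dense_span_htmul K L).induction (P := fun z => f z ∈ N.topologicalClosure) ?_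
      (N.isClosed_topologicalClosure.preimage hf) z
    intro z hz
    refine N.le_topologicalClosure ?_
    have : Submodule.span ℂ (Set.range fun p : K × L => htmul p.1 p.2) ≤ N.comap f := by
      rw [Submodule.span_le]
      rintro _ ⟨p, rfl⟩
      exact Submodule.subset_span ⟨(x, p.1, p.2), rfl⟩
    exact this hz
  rw [← dense_closure]
  refine (dense_span_htmul H (HilbertTensor K L)).mono ?_
  rw [← Submodule.topologicalClosure_coe, SetLike.coe_subset_coe, Submodule.span_le]
  rintro _ ⟨p, rfl⟩
  exact key p.1 p.2

/-- The elementary tensor of two vectors, in the space of the representation `π ⊗ ρ`. -/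
def rvec {π : HilbertRep A} {ρ : HilbertRep B} (x : π.space) (y : ρ.space) : (rep π ρ).space :=
  (htmul x y : HilbertTensor π.space ρ.space)

theorem inner_rvec {π : HilbertRep A} {ρ : HilbertRep B} (x x' : π.space) (y y' : ρ.space) :
    ⟪rvec x y, rvec x' y'⟫_ℂ = ⟪x, x'⟫_ℂ * ⟪y, y'⟫_ℂ :=
  inner_htmul x x' y y'

theorem rep_tmul_rvec {π : HilbertRep A} {ρ : HilbertRep B} (a : A) (b : B) (x : π.space)
    (y : ρ.space) : (rep π ρ).hom (tmul a b) (rvec x y) = rvec (π.hom a x) (ρ.hom b y) :=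
  (congrArg (fun T : HilbertTensor π.space ρ.space →L[ℂ] HilbertTensor π.space ρ.space =>
    T (htmul x y)) (rep_tmul π ρ a b)).trans (opTensor_htmul _ _ x y)

theorem dense_span_rvec₃ (π : HilbertRep A) (ρ : HilbertRep B) (σ : HilbertRep C) :
    Dense (Submodule.span ℂ (Set.range fun p : π.space × ρ.space × σ.space =>
      (rvec p.1 (rvec p.2.1 p.2.2) : (rep π (rep ρ σ)).space)) : Set (rep π (rep ρ σ)).space) :=
  dense_span_htmul₃ π.space ρ.space σ.space

theorem inner_rep_algAssoc {π : HilbertRep A} {ρ : HilbertRep B} {σ : HilbertRep C}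
    (i j : π.space × ρ.space × σ.space) (x : MinTensor A B ⊗[ℂ] C) :
    ⟪(rvec (rvec i.1 i.2.1) i.2.2 : (rep (rep π ρ) σ).space),
      (rep (rep π ρ) σ).hom (of _ _ x) (rvec (rvec j.1 j.2.1) j.2.2)⟫_ℂ =
    ⟪(rvec i.1 (rvec i.2.1 i.2.2) : (rep π (rep ρ σ)).space),
      (rep π (rep ρ σ)).hom (algAssoc A B C x) (rvec j.1 (rvec j.2.1 j.2.2))⟫_ℂ := by
  induction x using TensorProduct.induction_on with
  | zero => simp
  | add a b ha hb => simp only [map_add, add_apply, inner_add_right, ha, hb]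
  | tmul d c =>
    have e1 : ∀ d : MinTensor A B, of (MinTensor A B) C (d ⊗ₜ c) = inclLeft _ _ d * tmul 1 c :=
      fun d => by rw [inclLeft_apply, tmul_mul_tmul, mul_one, one_mul, tmul]
    simp only [algAssoc_tmul, e1]
    refine induction_tmul (p := fun d =>
      ⟪(rvec (rvec i.1 i.2.1) i.2.2 : (rep (rep π ρ) σ).space),
        (rep (rep π ρ) σ).hom (inclLeft _ _ d * tmul 1 c) (rvec (rvec j.1 j.2.1) j.2.2)⟫_ℂ =
      ⟪(rvec i.1 (rvec i.2.1 i.2.2) : (rep π (rep ρ σ)).space),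
        (rep π (rep ρ σ)).hom (map (.id ℂ A) (inclLeft B C) d * tmul (1 : A) (tmul (1 : B) c))
          (rvec j.1 (rvec j.2.1 j.2.2))⟫_ℂ) ?_ ?_ ?_ ?_ d
    · have h1 := continuous_hom (inclLeft (MinTensor A B) C)
      have h2 := continuous_hom (map (.id ℂ A) (inclLeft B C))
      have h3 := continuous_hom (rep (rep π ρ) σ).hom
      have h4 := continuous_hom (rep π (rep ρ σ)).hom
      apply isClosed_eq
      · exact continuous_const.inner ((h3.comp (h1.mul continuous_const)).clm_apply
          continuous_const)
      · exact continuous_const.inner ((h4.comp (h2.mul continuous_const)).clm_apply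
          continuous_const)
    · simp
    · intro d d' hd hd'
      simp only [map_add, add_mul, add_apply, inner_add_right, hd, hd']
    · intro a b
      rw [map_tmul, inclLeft_apply, inclLeft_apply, tmul_mul_tmul, tmul_mul_tmul, tmul_mul_tmul,
        rep_tmul_rvec, rep_tmul_rvec, inner_rvec, inner_rvec, mul_one, one_mul, mul_one, mul_one,
        rep_tmul_rvec, inner_rvec, StarAlgHom.coe_id, id_eq, rep_tmul_rvec, inner_rvec]
      ring

theorem norm_rep_algAssoc_le (π : HilbertRep A) (ρ : HilbertRep B) (σ : HilbertRep C)
    (x : MinTensor A B ⊗[ℂ] C) :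
    ‖(rep π (rep ρ σ)).hom (algAssoc A B C x)‖ ≤ spatialNorm x := by
  refine le_trans ?_ ((NonUnitalStarAlgHom.norm_apply_le (rep (rep π ρ) σ).hom (of _ _ x)).trans_eq
    (norm_of x))
  refine norm_le_of_gram
    (u := fun p : π.space × ρ.space × σ.space =>
      (rvec (rvec p.1 p.2.1) p.2.2 : (rep (rep π ρ) σ).space))
    (v := fun p : π.space × ρ.space × σ.space =>
      (rvec p.1 (rvec p.2.1 p.2.2) : (rep π (rep ρ σ)).space))
    _ _ (dense_span_rvec₃ _ _ _) ?_ ?_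
  · intro i j
    simp only [inner_rvec]
    ring
  · exact fun i j => inner_rep_algAssoc i j x

/-- The representations `π ⊗ (ρ ⊗ σ)` determine the norm of `A ⊗ (B ⊗ C)`. -/
theorem norm_le_of_rep₃ {x : MinTensor A (MinTensor B C)} {M : ℝ}
    (h : ∀ (π : HilbertRep A) (ρ : HilbertRep B) (σ : HilbertRep C),
      ‖(rep π (rep ρ σ)).hom x‖ ≤ M) : ‖x‖ ≤ M := by
  refine le_of_forall_pos_le_add fun ε hε => ?_
  obtain ⟨y, hy⟩ := Metric.denseRange_iff.mp (denseRange_of (A := A) (B := MinTensor B C)) x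
    (ε / 2) (half_pos hε)
  rw [dist_eq_norm] at hy
  have hM : 0 ≤ M := (norm_nonneg _).trans (h default default default)
  have h1 : ‖of _ _ y‖ ≤ M + ε / 2 := by
    rw [norm_of]
    refine spatialNorm_le fun π τ => ?_
    refine norm_algRep_le_of_faithful π
      (fun p : HilbertRep B × HilbertRep C => rep p.1 p.2) (fun d hd => ?_) τ y (by positivity)
      fun p => ?_
    · refine norm_le_zero_iff.mp (norm_le_of_rep fun ρ σ => ?_)
      rw [hd (ρ, σ), norm_zero]
    · rw [← rep_of]
      calc ‖(rep π (rep p.1 p.2)).hom (of _ _ y)‖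
          = ‖(rep π (rep p.1 p.2)).hom x - (rep π (rep p.1 p.2)).hom (x - of _ _ y)‖ := by
            rw [map_sub]; congr 1; abel
        _ ≤ ‖(rep π (rep p.1 p.2)).hom x‖ + ‖(rep π (rep p.1 p.2)).hom (x - of _ _ y)‖ :=
            norm_sub_le _ _
        _ ≤ M + ε / 2 := add_le_add (h π p.1 p.2)
            ((NonUnitalStarAlgHom.norm_apply_le _ _).trans hy.le)
  calc ‖x‖ = ‖of _ _ y + (x - of _ _ y)‖ := by congr 1; abel
    _ ≤ ‖of _ _ y‖ + ‖x - of _ _ y‖ := norm_add_le _ _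
    _ ≤ M + ε := by linarith

/-- The associativity homomorphism `(A ⊗ B) ⊗ C → A ⊗ (B ⊗ C)`, `(a ⊗ b) ⊗ c ↦ a ⊗ (b ⊗ c)`. -/
def assoc (A B C : Type u) [CStarAlgebra A] [CStarAlgebra B] [CStarAlgebra C] :
    MinTensor (MinTensor A B) C →⋆ₐ[ℂ] MinTensor A (MinTensor B C) :=
  lift (algAssoc A B C) fun x => norm_le_of_rep₃ fun π ρ σ => norm_rep_algAssoc_le π ρ σ x

theorem assoc_tmul (a : A) (b : B) (c : C) :
    assoc A B C (tmul (tmul a b) c) = tmul a (tmul b c) :=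
  (lift_of _ _ _).trans (algAssoc_tmul_tmul a b c)

end MinTensor

/-- A state of a unital C⋆-algebra: a positive linear functional of norm one. -/
structure State (A : Type u) [CStarAlgebra A] where
  /-- the functional -/
  toLinearMap : A →ₗ[ℂ] ℂ
  map_one : toLinearMap 1 = 1
  nonneg : ∀ a, 0 ≤ toLinearMap (star a * a)

instance : CoeFun (State A) fun _ => A → ℂ := ⟨fun h => h.toLinearMap⟩

/-- The GNS representation of a state. -/
theorem State.exists_rep (h : State A) : ∃ (π : HilbertRep A) (Ω : π.space), ‖Ω‖ = 1 ∧
    ∀ a, h a = ⟪Ω, π.hom a Ω⟫_ℂ := by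
  let _ := CStarAlgebra.spectralOrder A
  let _ := CStarAlgebra.spectralOrderedRing A
  let f : A →ₚ[ℂ] ℂ := PositiveLinearMap.mk₀ h.toLinearMap fun a ha => by
    obtain ⟨b, hb⟩ := CStarAlgebra.nonneg_iff_eq_star_mul_self.mp ha
    rw [hb]
    exact h.nonneg b
  have hinner : ∀ a, h a = ⟪((f.toPreGNS 1 : f.PreGNS) : f.GNS),
      f.gnsStarAlgHom a ((f.toPreGNS 1 : f.PreGNS) : f.GNS)⟫_ℂ := by
    intro a
    have e : f.gnsStarAlgHom a ((f.toPreGNS 1 : f.PreGNS) : f.GNS) =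
        ((f.leftMulMapPreGNS a (f.toPreGNS 1) : f.PreGNS) : f.GNS) :=
      PositiveLinearMap.gnsNonUnitalStarAlgHom_apply_coe f
    rw [e, Completion.inner_coe, PositiveLinearMap.preGNS_inner_def]
    simp only [PositiveLinearMap.leftMulMapPreGNS_apply, PositiveLinearMap.ofPreGNS_toPreGNS,
      star_one, one_mul, mul_one]
    rfl
  refine ⟨⟨f.GNS, f.gnsStarAlgHom⟩, ((f.toPreGNS 1 : f.PreGNS) : f.GNS), ?_, hinner⟩
  have h1 := hinner 1
  rw [h.map_one, _root_.map_one f.gnsStarAlgHom, one_apply_eq_self, inner_self_eq_norm_sq_to_K] at h1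
  have h2 : (‖((f.toPreGNS 1 : f.PreGNS) : f.GNS)‖ : ℝ) ^ 2 = 1 := by
    rw [← Complex.ofReal_inj, Complex.ofReal_one, h1]
    simp
  exact (pow_eq_one_iff_of_nonneg (norm_nonneg _) two_ne_zero).mp h2

theorem im_eq_zero_of_norm_le_one (f : StrongDual ℂ B) (hf : ‖f‖ ≤ 1) (h1 : f 1 = 1) (y : B)
    (hy : star y = y) : (f y).im = 0 := by
  have key : ∀ t : ℝ, ((f y).im + t) ^ 2 ≤ ‖y‖ ^ 2 + t ^ 2 := by
    intro t
    set z : B := y + (Complex.I * t : ℂ) • 1 with hz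
    have e1 : f z = f y + Complex.I * t := by simp [hz, h1]
    have e2 : star z * z = y * y + (t ^ 2 : ℂ) • 1 := by
      simp only [hz, star_add, star_smul, star_one, hy, add_mul, mul_add,
        mul_smul_comm, smul_mul_assoc, one_mul, mul_one]
      have : star (Complex.I * (t : ℂ)) = - (Complex.I * t) := by simp
      rw [this]
      have h3 : (Complex.I * (t : ℂ)) * -(Complex.I * t) = t ^ 2 := by
        linear_combination (-(t : ℂ) ^ 2) * Complex.I_mul_I
      rw [smul_add, smul_smul, h3, neg_smul]
      abel
    have e3 : ‖z‖ ^ 2 ≤ ‖y‖ ^ 2 + t ^ 2 := by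
      rw [sq, ← CStarRing.norm_star_mul_self, e2]
      refine (norm_add_le _ _).trans (add_le_add ((norm_mul_le _ _).trans_eq (sq _).symm) ?_)
      have : Nontrivial B := ⟨1, 0, fun h => by simp [h] at h1⟩
      rw [norm_smul, CStarRing.norm_one, mul_one]
      simp
    have e4 : ‖f z‖ ≤ ‖z‖ := (f.le_opNorm z).trans
      ((mul_le_mul_of_nonneg_right hf (norm_nonneg _)).trans_eq (one_mul _))
    have e5 : |(f z).im| ≤ ‖f z‖ := Complex.abs_im_le_norm _
    have e6 : (f z).im = (f y).im + t := by simp [e1]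
    rw [← e6, ← sq_abs]
    exact (pow_le_pow_left₀ (abs_nonneg _) (e5.trans e4) 2).trans e3
  by_contra hne
  have h2 := key ((‖y‖ ^ 2 + 1) / (2 * (f y).im))
  have h3 : 2 * (f y).im * ((‖y‖ ^ 2 + 1) / (2 * (f y).im)) = ‖y‖ ^ 2 + 1 := by
    field_simp
  nlinarith [sq_nonneg (f y).im]

/-- Every element of a C⋆-algebra is normed by a state. -/
theorem exists_norming_state (b : B) (hb : b ≠ 0) :
    ∃ ω : State B, ω (star b * b) = ((‖b‖ ^ 2 : ℝ) : ℂ) := by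
  let _ := CStarAlgebra.spectralOrder B
  let _ := CStarAlgebra.spectralOrderedRing B
  have : Nontrivial B := ⟨b, 0, hb⟩
  set a := star b * b with ha
  have ha0 : 0 ≤ a := star_mul_self_nonneg b
  have hna : ‖a‖ = ‖b‖ ^ 2 := by rw [ha, CStarRing.norm_star_mul_self, sq]
  have hapos : 0 < ‖a‖ := by rw [hna]; positivity
  have hle : ∀ y : B, 0 ≤ y → y ≤ (‖y‖ : ℂ) • 1 := fun y hy => by
    have := IsSelfAdjoint.le_algebraMap_norm_self (a := y) (IsSelfAdjoint.of_nonneg hy)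
    rwa [Algebra.algebraMap_eq_smul_one, ← Complex.coe_smul] at this
  set c : B := (‖a‖ : ℂ) • 1 + a with hc
  have hcn : 2 * ‖a‖ ≤ ‖c‖ := by
    have h1 : a + a ≤ c := by
      rw [hc]
      gcongr
      exact hle a ha0
    have h2 := CStarAlgebra.norm_le_norm_of_nonneg_of_le (add_nonneg ha0 ha0) h1
    rwa [← two_smul ℝ a, norm_smul, Real.norm_ofNat] at h2
  have hc0 : c ≠ 0 := by
    rintro h
    rw [h, norm_zero] at hcn
    linarith
  obtain ⟨f, hf, hfc⟩ := exists_dual_vector ℂ c (norm_ne_zero_iff.mpr hc0)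
  have hfle : ∀ y, ‖f y‖ ≤ ‖y‖ := fun y => (f.le_opNorm y).trans_eq (by rw [hf, one_mul])
  have h1n : ‖f 1‖ ≤ 1 := (hfle 1).trans_eq CStarRing.norm_one
  have hre : ‖a‖ * (f 1).re + (f a).re = ‖c‖ := by
    have := congrArg Complex.re hfc
    simpa [hc] using this
  have hr1 : (f 1).re ≤ 1 := (Complex.re_le_norm _).trans h1n
  have hra : (f a).re ≤ ‖a‖ := (Complex.re_le_norm _).trans (hfle a)
  have hr1' : (f 1).re = 1 := by nlinarith
  have hra' : (f a).re = ‖a‖ := by nlinarith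
  have hf1 : f 1 = 1 := by
    have h2 := Complex.sq_norm (f 1)
    rw [Complex.normSq_apply, hr1'] at h2
    have h3 : ‖f 1‖ ^ 2 ≤ 1 := by nlinarith [norm_nonneg (f 1)]
    have h4 : (f 1).im = 0 := by nlinarith
    exact Complex.ext hr1' h4
  refine ⟨⟨f.toLinearMap, hf1, fun y => ?_⟩, ?_⟩
  · set z := star y * y with hz
    have hz0 : 0 ≤ z := star_mul_self_nonneg y
    have him := im_eq_zero_of_norm_le_one f hf.le hf1 z (by rw [hz, star_mul, star_star])
    have hn : ‖(‖z‖ : ℂ) • (1 : B) - z‖ ≤ ‖z‖ := by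
      have h2 := CStarAlgebra.norm_le_norm_of_nonneg_of_le (sub_nonneg.mpr (hle z hz0))
        (sub_le_self ((‖z‖ : ℂ) • (1 : B)) hz0)
      refine h2.trans_eq ?_
      rw [norm_smul, CStarRing.norm_one, mul_one]
      simp
    have hr := (Complex.re_le_norm _).trans ((hfle _).trans hn)
    rw [map_sub, map_smul, hf1] at hr
    simp at hr
    exact Complex.le_def.mpr ⟨hr, him.symm⟩
  · refine Complex.ext ?_ ?_
    · rw [Complex.ofReal_re, ← hna]
      exact hra'
    · rw [Complex.ofReal_im]
      exact im_eq_zero_of_norm_le_one f hf.le hf1 a (by rw [ha, star_mul, star_star])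

/-- The slice map `h ⊗ id` on the algebraic tensor product. -/
def algSlice (B : Type u) [CStarAlgebra B] (h : State A) : A ⊗[ℂ] B →ₗ[ℂ] B :=
  TensorProduct.lift ((LinearMap.lsmul ℂ B).comp h.toLinearMap)

theorem algSlice_tmul (h : State A) (a : A) (b : B) : algSlice B h (a ⊗ₜ b) = h a • b := rfl

theorem norm_algSlice_le (h : State A) (x : A ⊗[ℂ] B) : ‖algSlice B h x‖ ≤ spatialNorm x := by
  by_cases hs : algSlice B h x = 0
  · rw [hs, norm_zero]
    exact spatialNorm_nonneg x
  obtain ⟨π, Ω, hΩ, hπ⟩ := h.exists_rep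
  obtain ⟨ω, hω⟩ := exists_norming_state _ hs
  obtain ⟨ρ, Ω', hΩ', hρ⟩ := ω.exists_rep
  have e1 : vecSlice π Ω Ω x = algSlice B h x := by
    have : vecSlice π Ω Ω = algSlice B h := TensorProduct.ext' fun a b => by
      rw [vecSlice_tmul, algSlice_tmul, hπ]
    rw [this]
  set s := algSlice B h x with hsdef
  rw [hρ, map_mul, map_star, mul_apply_eq_comp, ContinuousLinearMap.star_eq_adjoint,
    ContinuousLinearMap.adjoint_inner_right] at hω
  have e2 : ‖ρ.hom s Ω'‖ = ‖s‖ := by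
    rw [inner_self_eq_norm_sq_to_K] at hω
    have : ‖ρ.hom s Ω'‖ ^ 2 = ‖s‖ ^ 2 := by
      rw [← Complex.ofReal_inj, ← hω]
      simp
    exact (sq_eq_sq₀ (norm_nonneg _) (norm_nonneg _)).mp this
  have e3 := inner_algRep π ρ x Ω Ω (ρ.hom s Ω') Ω'
  rw [e1, hω] at e3
  have e4 : ‖s‖ ^ 2 ≤ ‖s‖ * spatialNorm x := by
    calc ‖s‖ ^ 2 = ‖((‖s‖ ^ 2 : ℝ) : ℂ)‖ := by simp
      _ ≤ ‖htmul Ω (ρ.hom s Ω')‖ * ‖algRep π ρ x (htmul Ω Ω')‖ := by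
          rw [← e3]
          exact norm_inner_le_norm _ _
      _ ≤ ‖htmul Ω (ρ.hom s Ω')‖ * (‖algRep π ρ x‖ * ‖htmul Ω Ω'‖) := by
          gcongr
          exact (algRep π ρ x).le_opNorm _
      _ = ‖s‖ * ‖algRep π ρ x‖ := by simp [htmul, hΩ, hΩ', e2]
      _ ≤ _ := by
          gcongr
          exact norm_algRep_le π ρ x
  have hpos : 0 < ‖s‖ := norm_pos_iff.mpr hs
  rw [sq] at e4
  exact le_of_mul_le_mul_left e4 hpos

namespace MinTensor

/-- `algSlice` as a continuous linear map for the spatial norm. -/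
def algSliceL (B : Type u) [CStarAlgebra B] (h : State A) : AlgTensor A B →L[ℂ] B :=
  LinearMap.mkContinuous
    ({ toFun := fun x => algSlice B h x
       map_add' := map_add (algSlice B h)
       map_smul' := map_smul (algSlice B h) } : AlgTensor A B →ₗ[ℂ] B) 1
    fun x => (norm_algSlice_le h x).trans_eq (one_mul _).symm

/-- The slice map `h ⊗ id : A ⊗ B → B`, `a ⊗ b ↦ h(a) b`. -/
def sliceLeft (B : Type u) [CStarAlgebra B] (h : State A) : MinTensor A B →L[ℂ] B :=
  ((algSliceL B h).fromCompletion : Completion (AlgTensor A B) →L[ℂ] B)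

/-- The slice map `id ⊗ h : A ⊗ B → A`, `a ⊗ b ↦ h(b) a`. -/
def sliceRight (A : Type u) [CStarAlgebra A] (h : State B) : MinTensor A B →L[ℂ] A :=
  (sliceLeft A h).comp ⟨(flip A B).toAlgHom.toLinearMap, continuous_hom (flip A B)⟩

theorem sliceLeft_tmul (h : State A) (a : A) (b : B) : sliceLeft B h (tmul a b) = h a • b :=
  ContinuousLinearMap.fromCompletion_apply_coe (algSliceL B h) (toAlg A B (a ⊗ₜ b))

theorem sliceRight_tmul (h : State B) (a : A) (b : B) : sliceRight A h (tmul a b) = h b • a := by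
  change sliceLeft A h (flip A B (tmul a b)) = _
  rw [flip_tmul, sliceLeft_tmul]

end MinTensor

section QuantumGroup

open MinTensor

/-- A compact quantum group in the sense of Woronowicz, with algebra `C(G) = A`: a coassociative
unital ⋆-homomorphism `Δ : A → A ⊗ A` (minimal tensor product) such that the linear spans of
`Δ(A)(1 ⊗ A)` and `Δ(A)(A ⊗ 1)` are dense in `A ⊗ A`. -/
structure CompactQuantumGroup (A : Type u) [CStarAlgebra A] where
  /-- the comultiplication -/
  comul : A →⋆ₐ[ℂ] MinTensor A A
  coassoc : ∀ a, assoc A A A (map comul (.id ℂ A) (comul a)) = map (.id ℂ A) comul (comul a)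
  dense_left : Dense (Submodule.span ℂ {x | ∃ a b : A, x = comul a * tmul 1 b} :
    Set (MinTensor A A))
  dense_right : Dense (Submodule.span ℂ {x | ∃ a b : A, x = comul a * tmul b 1} :
    Set (MinTensor A A))

/-- A state is tracial. -/
def State.IsTracial (h : State A) : Prop := ∀ a b, h (a * b) = h (b * a)

/-- A state is faithful. -/
def State.IsFaithful (h : State A) : Prop := ∀ a, h (star a * a) = 0 → a = 0

namespace CompactQuantumGroup

variable (G : CompactQuantumGroup A)

/-- `h` is the Haar state of `G`: `(h ⊗ id)Δ(a) = h(a) 1 = (id ⊗ h)Δ(a)` for all `a`. -/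
def IsHaarState (h : State A) : Prop :=
  ∀ a, sliceLeft A h (G.comul a) = h a • (1 : A) ∧ sliceRight A h (G.comul a) = h a • (1 : A)

/-- `u` is a finite dimensional unitary corepresentation of `G`. -/
structure IsUnitaryCorep {n : ℕ} (u : Matrix (Fin n) (Fin n) A) : Prop where
  unitary_mem : u ∈ unitary (Matrix (Fin n) (Fin n) A)
  comul_apply : ∀ i j, G.comul (u i j) = ∑ k, tmul (u i k) (u k j)

/-- `u` is an irreducible unitary corepresentation of `G`: it is not zero-dimensional, and its
only self-intertwiners are the scalar matrices. -/
structure IsIrreducibleCorep {n : ℕ} (u : Matrix (Fin n) (Fin n) A) : Prop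
    extends G.IsUnitaryCorep u where
  pos : 0 < n
  intertwiner : ∀ T : Matrix (Fin n) (Fin n) ℂ,
    T.map (algebraMap ℂ A) * u = u * T.map (algebraMap ℂ A) → ∃ c : ℂ, T = c • 1

/-- `Pol(G)`: the linear span of the matrix coefficients of the irreducible corepresentations. -/
def pol : Submodule ℂ A :=
  Submodule.span ℂ {a | ∃ (n : ℕ) (u : Matrix (Fin n) (Fin n) A) (i j : Fin n),
    G.IsIrreducibleCorep u ∧ a = u i j}

/-- The linear span of the irreducible characters `χ = ∑ᵢ uᵢᵢ`. -/
def characterSpan : Submodule ℂ A :=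
  Submodule.span ℂ {a | ∃ (n : ℕ) (u : Matrix (Fin n) (Fin n) A),
    G.IsIrreducibleCorep u ∧ a = u.trace}

/-- `C(G)_central = {a ∈ C(G) | Δ(a) = ΣΔ(a)}`, with `Σ` the flip. -/
def central : StarSubalgebra ℂ A :=
  StarAlgHom.equalizer G.comul ((flip A A).comp G.comul)

/-- `Pol(G)_central = {a ∈ Pol(G) | Δ(a) = ΣΔ(a)}`. -/
def polCentral : Submodule ℂ A :=
  G.pol ⊓ Subalgebra.toSubmodule G.central.toSubalgebra

end CompactQuantumGroup

end QuantumGroup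

end

end CStarTensor

/-! Write `Ω` for the GNS vector of `h` and `Σ` for the flip. Invariance of `h` makes `aΩ ↦ Δ(a)(Ω ⊗
Ω)` isometric. Call `q` the value `Δ⋆(w)` of the adjoint at `w ∈ A ⊗ A` when `h(q y) = (h ⊗ h)(w
Δ(y))` for all `y`. Because `h` is a faithful trace, `‖q‖ ≤ ‖w‖` in the C⋆-norm, not only in the
Hilbert space norm (`norm_le_of_tensor_comul`).

The proof rests on the map `a ↦ Δ⋆(ΣΔ(a))`. It fixes every central `a`, since then `(h ⊗
h)(ΣΔ(a)Δ(y)) = (h ⊗ h)(Δ(ay)) = h(ay)`. By the orthogonality relations it sends a coefficient `u i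
j` of an irreducible corepresentation of dimension `n` to `δ_ij n⁻¹ χ_u`, hence `Pol(G)` into the
span of the characters. So each `p ∈ Pol(G)` yields a combination `q` of characters with `‖q - a‖ ≤
‖p - a‖` for all central `a` (`exists_characterSpan_norm_sub_le`). Taking `p = a` identifies the
central part of `Pol(G)`; letting `p → a` gives the closure. `Δ⋆` is never needed on all of `A ⊗ A`,
only where its value is exhibited.

What remains is the density of `Pol(G)` (`dense_pol`), a Peter–Weyl argument. The convolution
operators `K_a x = (id ⊗ h)((1 ⊗ a)Δ(x))` extend to compact operators from the GNS space into `A`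
and commute with translation. The eigenspaces of `K_a K_a⋆` for non-zero eigenvalues are therefore
finite dimensional, contained in `A` and invariant under `Δ`, so they carry unitary
corepresentations (`exists_corep_eigenspace`), whose coefficients lie in `Pol(G)` by complete
reducibility (`apply_mem_pol`). The spectral theorem makes the eigenvectors numerous enough, and
since `K_a` is bounded from the GNS norm to the C⋆-norm, density in the Hilbert space becomes
density in `A`. -/

namespace CStarTensor

noncomputable section

open scoped TensorProduct InnerProductSpace ComplexOrder
open UniformSpace MinTensor

variable {A B C : Type u} [CStarAlgebra A] [CStarAlgebra B] [CStarAlgebra C]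

/-! ### GNS data and vectors in tensor products of representations -/

/-- A cyclic representation implementing a state. -/
structure State.GNSData (h : State A) where
  /-- the representation -/
  rep : HilbertRep A
  /-- the cyclic vector -/
  vec : rep.space
  apply_eq : ∀ a, h a = ⟪vec, rep.hom a vec⟫_ℂ
  dense : DenseRange fun a => rep.hom a vec

theorem State.nonempty_gnsData (h : State A) : Nonempty h.GNSData := by
  let _ := CStarAlgebra.spectralOrder A
  let _ := CStarAlgebra.spectralOrderedRing A
  let f : A →ₚ[ℂ] ℂ := PositiveLinearMap.mk₀ h.toLinearMap fun a ha => by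
    obtain ⟨b, hb⟩ := CStarAlgebra.nonneg_iff_eq_star_mul_self.mp ha
    rw [hb]
    exact h.nonneg b
  have e : ∀ a, f.gnsStarAlgHom a ((f.toPreGNS 1 : f.PreGNS) : f.GNS) =
      ((f.toPreGNS a : f.PreGNS) : f.GNS) := fun a => by
    refine (PositiveLinearMap.gnsNonUnitalStarAlgHom_apply_coe f).trans ?_
    simp
  refine ⟨⟨⟨f.GNS, f.gnsStarAlgHom⟩, ((f.toPreGNS 1 : f.PreGNS) : f.GNS), fun a => ?_, ?_⟩⟩
  · rw [e, Completion.inner_coe, PositiveLinearMap.preGNS_inner_def]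
    simp only [PositiveLinearMap.ofPreGNS_toPreGNS, star_one, one_mul]
    rfl
  · refine (Completion.denseRange_coe (α := f.PreGNS)).mono ?_
    rintro _ ⟨a, rfl⟩
    exact ⟨f.ofPreGNS a, e _⟩

theorem inner_hom_star (π : HilbertRep A) (a : A) (x y : π.space) :
    ⟪π.hom (star a) x, y⟫_ℂ = ⟪x, π.hom a y⟫_ℂ := by
  rw [map_star, ContinuousLinearMap.star_eq_adjoint, ContinuousLinearMap.adjoint_inner_left]

theorem inner_hom_left (π : HilbertRep A) (a : A) (x y : π.space) :
    ⟪π.hom a x, y⟫_ℂ = ⟪x, π.hom (star a) y⟫_ℂ := by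
  rw [← inner_hom_star, star_star]

theorem hom_mul_apply (π : HilbertRep A) (a b : A) (x : π.space) :
    π.hom (a * b) x = π.hom a (π.hom b x) := by
  rw [map_mul]; rfl

theorem continuous_hom_apply (π : HilbertRep A) (x : π.space) :
    Continuous fun a => π.hom a x :=
  (continuous_hom π.hom).clm_apply continuous_const

theorem norm_hom_le (π : HilbertRep A) (a : A) : ‖π.hom a‖ ≤ ‖a‖ :=
  NonUnitalStarAlgHom.norm_apply_le π.hom a

theorem norm_rvec {π : HilbertRep A} {ρ : HilbertRep B} (x : π.space) (y : ρ.space) :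
    ‖(rvec x y : (MinTensor.rep π ρ).space)‖ = ‖x‖ * ‖y‖ := by
  change ‖HilbertTensor.of _ _ (x ⊗ₜ y)‖ = _
  simp

/-- The tensor product of vectors as a bounded bilinear map. -/
def rvecL (π : HilbertRep A) (ρ : HilbertRep B) :
    π.space →L[ℂ] ρ.space →L[ℂ] (MinTensor.rep π ρ).space :=
  LinearMap.mkContinuous₂ (LinearMap.mk₂ ℂ rvec (fun x x' y => htmul_add_left x x' y)
    (fun c x y => htmul_smul_left c x y) (fun x y y' => htmul_add_right x y y')
    (fun c x y => htmul_smul_right c x y)) 1 fun x y => by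
      rw [one_mul]
      exact (norm_rvec x y).le

theorem rvecL_apply (π : HilbertRep A) (ρ : HilbertRep B) (x : π.space) (y : ρ.space) :
    rvecL π ρ x y = rvec x y := rfl

theorem continuous_rvec (π : HilbertRep A) (ρ : HilbertRep B) :
    Continuous fun p : π.space × ρ.space => (rvec p.1 p.2 : (MinTensor.rep π ρ).space) := by
  have : Continuous fun p : π.space × ρ.space => rvecL π ρ p.1 p.2 := by fun_prop
  exact this

theorem dense_span_rvec (π : HilbertRep A) (ρ : HilbertRep B) :
    Dense (Submodule.span ℂ (Set.range fun p : π.space × ρ.space =>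
      (rvec p.1 p.2 : (MinTensor.rep π ρ).space)) : Set (MinTensor.rep π ρ).space) :=
  dense_span_htmul π.space ρ.space

/-- A vector is determined by its inner products with a total set. -/
theorem ext_inner_of_dense_span {H : Type*} [NormedAddCommGroup H] [InnerProductSpace ℂ H]
    {s : Set H} (hs : Dense (Submodule.span ℂ s : Set H)) {v w : H}
    (hvw : ∀ x ∈ s, ⟪x, v⟫_ℂ = ⟪x, w⟫_ℂ) : v = w := by
  refine hs.eq_of_inner_right (𝕜 := ℂ) fun x hx => ?_
  induction hx using Submodule.span_induction with
  | mem x hx => exact hvw x hx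
  | zero => simp
  | add x y _ _ hx hy => rw [inner_add_left, inner_add_left, hx, hy]
  | smul c x _ hx => rw [inner_smul_left, inner_smul_left, hx]

theorem tmul_eq_mul (a : A) (b : B) : tmul a b = tmul a 1 * tmul 1 b := by
  rw [tmul_mul_tmul, mul_one, one_mul]

theorem tmul_one_one : (tmul (1 : A) (1 : B)) = 1 := map_one (inclLeft A B)

/-! ### The GNS embedding of the algebra and slices as matrix coefficients -/

namespace State.GNSData

variable {h : State A} (R : h.GNSData)

/-- The canonical map from the algebra to the GNS space. -/
def emb : A →L[ℂ] R.rep.space :=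
  (ContinuousLinearMap.apply ℂ R.rep.space R.vec).comp
    ⟨R.rep.hom.toAlgHom.toLinearMap, continuous_hom R.rep.hom⟩

theorem emb_apply (a : A) : R.emb a = R.rep.hom a R.vec := rfl

theorem emb_one : R.emb 1 = R.vec := by rw [emb_apply, _root_.map_one]; rfl

theorem denseRange_emb : DenseRange R.emb := R.dense

theorem emb_mul (a b : A) : R.emb (a * b) = R.rep.hom a (R.emb b) := hom_mul_apply _ _ _ _

theorem inner_emb (a b : A) : ⟪R.emb a, R.emb b⟫_ℂ = h (star a * b) := by
  rw [R.apply_eq, hom_mul_apply, emb_apply, inner_hom_left]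
  rfl

theorem norm_emb_sq (a : A) : ((‖R.emb a‖ ^ 2 : ℝ) : ℂ) = h (star a * a) := by
  rw [← R.inner_emb, inner_self_eq_norm_sq_to_K]
  simp

theorem continuous_state (R : h.GNSData) : Continuous h.toLinearMap := by
  have hc : Continuous fun a => ⟪R.vec, R.emb a⟫_ℂ :=
    continuous_const.inner R.emb.continuous
  exact hc.congr fun a => (R.apply_eq a).symm

theorem norm_vec : ‖R.vec‖ = 1 := by
  have h1 := R.norm_emb_sq 1
  rw [star_one, one_mul, h.map_one, emb_one] at h1
  exact (pow_eq_one_iff_of_nonneg (norm_nonneg _) two_ne_zero).mp (by exact_mod_cast h1)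

theorem emb_injective (hf : h.IsFaithful) : Function.Injective R.emb := by
  refine (injective_iff_map_eq_zero R.emb).mpr fun a ha => hf a ?_
  rw [← R.norm_emb_sq, ha]
  simp

theorem hom_injective (hf : h.IsFaithful) : Function.Injective R.rep.hom := by
  refine (injective_iff_map_eq_zero R.rep.hom).mpr fun a ha => R.emb_injective hf ?_
  rw [emb_apply, ha, map_zero]
  rfl

theorem norm_hom (hf : h.IsFaithful) (a : A) : ‖R.rep.hom a‖ = ‖a‖ :=
  NonUnitalStarAlgHom.norm_map R.rep.hom (R.hom_injective hf) a

/-- The operator norm in the GNS representation is tested on vectors of the form `aΩ`. -/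
theorem norm_le_of_inner_emb (hf : h.IsFaithful) {q : A} {M : ℝ} (hM : 0 ≤ M)
    (hq : ∀ c d, ‖⟪R.emb d, R.rep.hom q (R.emb c)⟫_ℂ‖ ≤ M * ‖R.emb d‖ * ‖R.emb c‖) : ‖q‖ ≤ M := by
  rw [← R.norm_hom hf]
  have key : ∀ x y, ‖⟪x, R.rep.hom q y⟫_ℂ‖ ≤ M * ‖x‖ * ‖y‖ := by
    refine isClosed_property2 R.denseRange_emb ?_ fun d c => hq c d
    apply isClosed_le <;> fun_prop
  refine ContinuousLinearMap.opNorm_le_of_re_inner_le hM fun x y hx hy => ?_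
  refine (RCLike.re_le_norm _).trans ?_
  rw [norm_inner_symm]
  simpa [hx, hy] using key y x

/-- The cyclic representation `π ⊗ π` of `A ⊗ A`. -/
abbrev tensorRep : HilbertRep (MinTensor A A) := MinTensor.rep R.rep R.rep

/-- The vector `Ω ⊗ Ω`. -/
abbrev tensorVec : R.tensorRep.space := rvec R.vec R.vec

/-- The dictionary between slice maps and vectors: inner products against `ξ ⊗ bΩ` are matrix
coefficients of slices. By linearity and continuity only elementary tensors need checking. -/
theorem inner_rvec_emb_rep (σ : HilbertRep B) (ξ η : σ.space) (b : A) (z : MinTensor B A) :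
    ⟪rvec ξ (R.emb b), (MinTensor.rep σ R.rep).hom z (rvec η R.vec)⟫_ℂ =
      ⟪ξ, σ.hom (sliceRight B h (tmul 1 (star b) * z)) η⟫_ℂ := by
  refine induction_tmul (p := fun z =>
    ⟪rvec ξ (R.emb b), (MinTensor.rep σ R.rep).hom z (rvec η R.vec)⟫_ℂ =
      ⟪ξ, σ.hom (sliceRight B h (tmul 1 (star b) * z)) η⟫_ℂ) ?_ ?_ ?_ ?_ z
  · have h1 := continuous_hom_apply (MinTensor.rep σ R.rep) (rvec η R.vec)
    have h2 := continuous_hom_apply σ η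
    refine isClosed_eq (continuous_const.inner h1) (continuous_const.inner (h2.comp ?_))
    fun_prop
  · simp
  · intro x y hx hy
    simp only [map_add, mul_add, add_apply, inner_add_right, hx, hy]
  · intro a c
    rw [rep_tmul_rvec, inner_rvec, tmul_mul_tmul, one_mul, sliceRight_tmul, map_smul, smul_apply,
      inner_smul_right, mul_comm, ← R.inner_emb]
    rfl

theorem inner_rvec_vec_rep (σ : HilbertRep B) (ξ η : σ.space) (z : MinTensor B A) :
    ⟪rvec ξ R.vec, (MinTensor.rep σ R.rep).hom z (rvec η R.vec)⟫_ℂ =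
      ⟪ξ, σ.hom (sliceRight B h z) η⟫_ℂ := by
  have := R.inner_rvec_emb_rep σ ξ η 1 z
  rwa [emb_one, star_one, tmul_one_one, one_mul] at this

theorem rep_tmul_vec (a b : A) : R.tensorRep.hom (tmul a b) R.tensorVec = rvec (R.emb a) (R.emb b) :=
  rep_tmul_rvec a b _ _

theorem ext_inner_rvec_emb {v w : R.tensorRep.space}
    (H : ∀ b d, ⟪(rvec (R.emb b) (R.emb d) : R.tensorRep.space), v⟫_ℂ =
      ⟪(rvec (R.emb b) (R.emb d) : R.tensorRep.space), w⟫_ℂ) : v = w := by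
  refine ext_inner_of_dense_span (dense_span_rvec R.rep R.rep) ?_
  rintro _ ⟨⟨x, y⟩, rfl⟩
  have hc := continuous_rvec R.rep R.rep
  refine isClosed_property2 (p := fun x y => ⟪(rvec x y : R.tensorRep.space), v⟫_ℂ =
    ⟪(rvec x y : R.tensorRep.space), w⟫_ℂ) R.denseRange_emb ?_ H x y
  exact isClosed_eq (hc.inner continuous_const) (hc.inner continuous_const)

theorem ext_inner_rvec {v w : R.tensorRep.space}
    (H : ∀ ξ η, ⟪(rvec ξ η : R.tensorRep.space), v⟫_ℂ = ⟪(rvec ξ η : R.tensorRep.space), w⟫_ℂ) :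
    v = w :=
  R.ext_inner_rvec_emb fun _ _ => H _ _

/-- One faithful representation in each leg already computes the spatial norm.
`norm_algRep_le_of_faithful` replaces the representation in the second leg only; conjugating by the
flip treats the first. -/
theorem norm_le_norm_tensorRep (hf : h.IsFaithful) (z : MinTensor A A) :
    ‖z‖ ≤ ‖R.tensorRep.hom z‖ := by
  have hinj : ∀ d : A, (∀ _ : Unit, R.rep.hom d = 0) → d = 0 := fun d hd =>
    R.hom_injective hf (by rw [hd (), map_zero])
  refine isClosed_property (p := fun z => ‖z‖ ≤ ‖R.tensorRep.hom z‖) denseRange_of ?_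
    (fun x => ?_) z
  · have := continuous_hom R.tensorRep.hom
    exact isClosed_le continuous_norm this.norm
  · rw [norm_of, rep_of]
    refine spatialNorm_le fun σ τ => ?_
    have key : ∀ (σ : HilbertRep A) y, ‖algRep σ τ y‖ ≤ ‖algRep σ R.rep y‖ := fun σ y =>
      norm_algRep_le_of_faithful σ (fun _ : Unit => R.rep) hinj τ y (norm_nonneg _) fun _ => le_rfl
    have key' : ‖algRep R.rep σ (algComm A A x)‖ ≤ ‖algRep R.rep R.rep (algComm A A x)‖ :=
      norm_algRep_le_of_faithful R.rep (fun _ : Unit => R.rep) hinj σ _ (norm_nonneg _)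
        fun _ => le_rfl
    have hcc : algComm A A (algComm A A x) = x := by
      clear key'
      induction x using TensorProduct.induction_on with
      | zero => simp
      | add a b ha hb => rw [map_add, map_add, ha, hb]
      | tmul a b => rfl
    calc ‖algRep σ τ x‖ ≤ ‖algRep σ R.rep x‖ := key σ x
      _ = ‖algRep σ R.rep (algComm A A (algComm A A x))‖ := by rw [hcc]
      _ ≤ ‖algRep R.rep σ (algComm A A x)‖ := norm_algRep_algComm _ _ _
      _ ≤ _ := key'
      _ ≤ _ := norm_algRep_algComm _ _ _

end State.GNSData

/-! ### The trace `h ⊗ h` and its separating vector -/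

/-- The state `h ⊗ h` on `A ⊗ A`. -/
def State.tensor (h : State A) (z : MinTensor A A) : ℂ := h (sliceRight A h z)

namespace State.GNSData

variable {h : State A} (R : h.GNSData)

theorem inner_tensorVec (z : MinTensor A A) :
    ⟪R.tensorVec, R.tensorRep.hom z R.tensorVec⟫_ℂ = h.tensor z := by
  rw [R.inner_rvec_vec_rep, State.tensor, R.apply_eq]

theorem continuous_tensor (R : h.GNSData) : Continuous h.tensor :=
  R.continuous_state.comp (sliceRight A h).continuous

theorem inner_rep_tensorVec (x y z : MinTensor A A) :
    ⟪R.tensorRep.hom x R.tensorVec, R.tensorRep.hom z (R.tensorRep.hom y R.tensorVec)⟫_ℂ =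
      h.tensor (star x * z * y) := by
  rw [← R.inner_tensorVec, hom_mul_apply, hom_mul_apply, inner_hom_left]

theorem tensor_mul_comm (R : h.GNSData) (ht : h.IsTracial) (x y : MinTensor A A) :
    h.tensor (x * y) = h.tensor (y * x) := by
  have hc := R.continuous_tensor
  have hadd : ∀ x y, h.tensor (x + y) = h.tensor x + h.tensor y := fun x y => by
    simp [State.tensor]
  have h0 : h.tensor 0 = 0 := by simp [State.tensor]
  refine induction_tmul (p := fun x => h.tensor (x * y) = h.tensor (y * x)) ?_ ?_ ?_ ?_ x
  · apply isClosed_eq <;> fun_prop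
  · simp
  · intro x x' hx hx'
    rw [add_mul, mul_add, hadd, hadd, hx, hx']
  · intro a b
    refine induction_tmul (p := fun y => h.tensor (tmul a b * y) = h.tensor (y * tmul a b))
      ?_ ?_ ?_ ?_ y
    · apply isClosed_eq <;> fun_prop
    · simp
    · intro x x' hx hx'
      rw [add_mul, mul_add, hadd, hadd, hx, hx']
    · intro c d
      simp only [State.tensor, tmul_mul_tmul, sliceRight_tmul, map_smul]
      rw [ht a c, ht b d]

/-- For a faithful trace, `Ω ⊗ Ω` is separating. -/
theorem eq_zero_of_rep_tensorVec (hf : h.IsFaithful) (ht : h.IsTracial) {z : MinTensor A A}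
    (hz : R.tensorRep.hom z R.tensorVec = 0) : z = 0 := by
  have h1 : ∀ y, h.tensor (y * z) = 0 := fun y => by
    rw [← R.inner_tensorVec, hom_mul_apply, hz, map_zero, inner_zero_right]
  have h2 : R.tensorRep.hom z = 0 := by
    refine clm_ext fun x y => ?_
    change R.tensorRep.hom z (rvec x y : R.tensorRep.space) = 0
    refine isClosed_property2 (p := fun x y => R.tensorRep.hom z (rvec x y) = 0)
      R.denseRange_emb ?_ (fun c d => ?_) x y
    · exact isClosed_eq ((R.tensorRep.hom z).continuous.comp (continuous_rvec R.rep R.rep))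
        continuous_const
    · refine R.ext_inner_rvec_emb fun a b => ?_
      -- The trace property moves `y` to the front: `(h ⊗ h)(x⋆ z y) = (h ⊗ h)(y x⋆ z)`, which
      -- vanishes because `z` kills `Ω ⊗ Ω`.
      rw [← R.rep_tmul_vec, ← R.rep_tmul_vec, R.inner_rep_tensorVec, inner_zero_right,
        R.tensor_mul_comm ht, ← mul_assoc, h1]
  refine norm_le_zero_iff.mp ((R.norm_le_norm_tensorRep hf z).trans ?_)
  rw [h2, norm_zero]

/-- Lets an identity in the C⋆-algebra `A ⊗ A` be proved as an identity between vectors of the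
Hilbert space, where invariance and spectral theory are available. -/
theorem eq_of_rep_tensorVec (hf : h.IsFaithful) (ht : h.IsTracial) {z w : MinTensor A A}
    (hz : R.tensorRep.hom z R.tensorVec = R.tensorRep.hom w R.tensorVec) : z = w := by
  refine sub_eq_zero.mp (R.eq_zero_of_rep_tensorVec hf ht ?_)
  rw [map_sub, sub_apply, hz, sub_self]

end State.GNSData

namespace MinTensor

theorem sliceRight_tmul_one_mul (h : State A) (b : B) (z : MinTensor B A) :
    sliceRight B h (tmul b 1 * z) = b * sliceRight B h z := by
  refine induction_tmul (p := fun z => sliceRight B h (tmul b 1 * z) = b * sliceRight B h z)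
    ?_ ?_ ?_ ?_ z
  · apply isClosed_eq <;> fun_prop
  · simp
  · intro x y hx hy
    rw [mul_add, map_add, map_add, mul_add, hx, hy]
  · intro a c
    rw [tmul_mul_tmul, one_mul, sliceRight_tmul, sliceRight_tmul, mul_smul_comm]

theorem sum_tmul {ι : Type*} (s : Finset ι) (f : ι → A) (b : B) :
    tmul (∑ i ∈ s, f i) b = ∑ i ∈ s, tmul (f i) b := by
  simp only [tmul, TensorProduct.sum_tmul, map_sum]

end MinTensor

/-! ### Invariance as an isometry, and the adjoint of the comultiplication -/

namespace CompactQuantumGroup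

variable (G : CompactQuantumGroup A) {h : State A} (R : h.GNSData)

variable {G} in
theorem IsHaarState.sliceRight_comul (hH : G.IsHaarState h) (a : A) :
    sliceRight A h (G.comul a) = h a • (1 : A) := (hH a).2

variable {G} in
theorem IsHaarState.tensor_comul (hH : G.IsHaarState h) (a : A) :
    h.tensor (G.comul a) = h a := by
  rw [State.tensor, hH.sliceRight_comul, map_smul, h.map_one, smul_eq_mul, mul_one]

/-- Moving `Δ(d)` across leaves `(id ⊗ h)Δ(d⋆y) = h(d⋆y) 1`. Thus `ξ ⊗ dΩ ↦ Δ(d)(ξ ⊗ Ω)` is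
isometric, which is the multiplicative unitary in disguise; the free vector `ξ` is needed for the
bounds on convolution operators. -/
theorem inner_comul (hH : G.IsHaarState h) (ξ η : R.rep.space) (d y : A) :
    ⟪R.tensorRep.hom (G.comul d) (rvec ξ R.vec), R.tensorRep.hom (G.comul y) (rvec η R.vec)⟫_ℂ =
      ⟪ξ, η⟫_ℂ * ⟪R.emb d, R.emb y⟫_ℂ := by
  rw [inner_hom_left, ← hom_mul_apply, ← map_star, ← map_mul, R.inner_rvec_vec_rep,
    hH.sliceRight_comul, map_smul, map_one, smul_apply, inner_smul_right, R.inner_emb, mul_comm]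
  rfl

theorem norm_comul_rvec (hH : G.IsHaarState h) (ξ : R.rep.space) (d : A) :
    ‖R.tensorRep.hom (G.comul d) (rvec ξ R.vec)‖ = ‖ξ‖ * ‖R.emb d‖ := by
  have h1 := G.inner_comul R hH ξ ξ d d
  rw [inner_self_eq_norm_sq_to_K, inner_self_eq_norm_sq_to_K, inner_self_eq_norm_sq_to_K,
    ← mul_pow] at h1
  have h2 : ‖R.tensorRep.hom (G.comul d) (rvec ξ R.vec)‖ ^ 2 = (‖ξ‖ * ‖R.emb d‖) ^ 2 := by
    exact_mod_cast h1
  exact (sq_eq_sq₀ (norm_nonneg _) (by positivity)).mp h2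

/-- The adjoint of the comultiplication with respect to a tracial Haar state is contractive. -/
theorem norm_le_of_tensor_comul (R : h.GNSData) (hH : G.IsHaarState h) (ht : h.IsTracial) (hf : h.IsFaithful)
    {q : A} {w : MinTensor A A} (H : ∀ y, h (q * y) = h.tensor (w * G.comul y)) : ‖q‖ ≤ ‖w‖ := by
  refine R.norm_le_of_inner_emb hf (norm_nonneg _) fun c d => ?_
  -- By the trace property `h(d⋆qc) = h(q c d⋆) = (h ⊗ h)(w Δ(c) Δ(d)⋆)`, and the trace property of
  -- `h ⊗ h` returns `Δ(d)⋆` to the left. So `q` is the compression of `w` along an isometry.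
  have e : ⟪R.emb d, R.rep.hom q (R.emb c)⟫_ℂ =
      ⟪R.tensorRep.hom (G.comul d) R.tensorVec,
        R.tensorRep.hom w (R.tensorRep.hom (G.comul c) R.tensorVec)⟫_ℂ := by
    rw [R.inner_rep_tensorVec, ← R.emb_mul, R.inner_emb, ht, mul_assoc, H, map_mul, map_star,
      ← mul_assoc, R.tensor_mul_comm ht, ← mul_assoc]
  rw [e]
  have h1 : ∀ d, ‖R.tensorRep.hom (G.comul d) R.tensorVec‖ = ‖R.emb d‖ := fun d => by
    rw [G.norm_comul_rvec R hH, R.norm_vec, one_mul]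
  calc _ ≤ ‖R.tensorRep.hom (G.comul d) R.tensorVec‖ *
        ‖R.tensorRep.hom w (R.tensorRep.hom (G.comul c) R.tensorVec)‖ := norm_inner_le_norm _ _
    _ ≤ ‖R.tensorRep.hom (G.comul d) R.tensorVec‖ *
        (‖w‖ * ‖R.tensorRep.hom (G.comul c) R.tensorVec‖) := by
        gcongr
        exact ((R.tensorRep.hom w).le_opNorm _).trans
          (mul_le_mul_of_nonneg_right (norm_hom_le _ w) (norm_nonneg _))
    _ = _ := by rw [h1, h1]; ring

/-! ### Orthogonality relations for irreducible corepresentations -/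

section Corep

variable {G} {n : ℕ} {u : Matrix (Fin n) (Fin n) A}

theorem IsUnitaryCorep.sum_star_mul (hu : G.IsUnitaryCorep u) (i j : Fin n) :
    ∑ l, star (u l i) * u l j = if i = j then 1 else 0 := by
  have := congrArg (fun M : Matrix (Fin n) (Fin n) A => M i j) hu.unitary_mem.1
  simpa [Matrix.mul_apply, Matrix.star_apply, Matrix.one_apply] using this

/-- Unitarity gives `1 ⊗ u_ik = ∑ₗ (u_li⋆ ⊗ 1) Δ(u_lk)`, so that `Δ(y)` can be absorbed into `Δ(u_lk
y)` and sliced by invariance. This replaces any appeal to an antipode. -/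
theorem IsUnitaryCorep.slice_one_tmul_mul_comul (hu : G.IsUnitaryCorep u) (hH : G.IsHaarState h)
    (i k : Fin n) (y : A) : sliceRight A h (tmul 1 (u i k) * G.comul y) =
      ∑ l, h (u l k * y) • star (u l i) := by
  have e : (tmul 1 (u i k) : MinTensor A A) = ∑ l, tmul (star (u l i)) 1 * G.comul (u l k) := by
    simp only [hu.comul_apply, Finset.mul_sum, tmul_mul_tmul, one_mul]
    rw [Finset.sum_comm]
    simp only [← sum_tmul, hu.sum_star_mul]
    rw [Finset.sum_eq_single i]
    · simp
    · intro b _ hb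
      rw [if_neg (Ne.symm hb)]
      simp [tmul]
    · simp
  rw [e, Finset.sum_mul, map_sum]
  refine Finset.sum_congr rfl fun l _ => ?_
  rw [mul_assoc, ← map_mul, sliceRight_tmul_one_mul, hH.sliceRight_comul, mul_smul_comm, mul_one]

/-- The matrix `M_kl = h(u_kj u_li⋆)` is the Haar average of a matrix unit. Invariance says `M = u M
u⋆`, and multiplying by `u` on the right gives `M u = u M`. -/
theorem IsUnitaryCorep.haar_intertwiner (hu : G.IsUnitaryCorep u) (hH : G.IsHaarState h)
    (i j k m : Fin n) :
    ∑ l, h (u k j * star (u l i)) • u l m = ∑ l, h (u l j * star (u m i)) • u k l := by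
  have hinv : ∀ l, h (u k j * star (u l i)) • (1 : A) =
      ∑ a, ∑ b, h (u a j * star (u b i)) • (u k a * star (u l b)) := by
    intro l
    rw [← hH.sliceRight_comul, map_mul, map_star, hu.comul_apply,
      hu.comul_apply, star_sum, Finset.sum_mul_sum, map_sum]
    refine Finset.sum_congr rfl fun a _ => ?_
    rw [map_sum]
    refine Finset.sum_congr rfl fun b _ => ?_
    rw [star_tmul, tmul_mul_tmul, sliceRight_tmul]
  have e : ∀ l, h (u k j * star (u l i)) • u l m =
      ∑ a, ∑ b, h (u a j * star (u b i)) • (u k a * (star (u l b) * u l m)) := by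
    intro l
    rw [← one_mul (u l m), ← smul_mul_assoc, hinv, one_mul, Finset.sum_mul]
    simp only [Finset.sum_mul, smul_mul_assoc, mul_assoc]
  simp only [e]
  rw [Finset.sum_comm]
  refine Finset.sum_congr rfl fun a _ => ?_
  rw [Finset.sum_comm]
  simp only [← Finset.smul_sum, ← Finset.mul_sum, hu.sum_star_mul]
  simp

/-- Orthogonality relations. -/
theorem IsIrreducibleCorep.haar_mul_star (hu : G.IsIrreducibleCorep u) (hH : G.IsHaarState h)
    (ht : h.IsTracial) (k j l i : Fin n) :
    h (u k j * star (u l i)) = if k = l ∧ i = j then (n : ℂ)⁻¹ else 0 := by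
  obtain ⟨c, hc⟩ := hu.intertwiner (Matrix.of fun k l => h (u k j * star (u l i))) (by
    ext k m
    rw [Matrix.mul_apply, Matrix.mul_apply]
    simp only [Matrix.map_apply, Matrix.of_apply, Algebra.algebraMap_eq_smul_one,
      smul_mul_assoc, mul_smul_comm, mul_one, one_mul]
    exact hu.haar_intertwiner hH i j k m)
  have hM : ∀ k l, h (u k j * star (u l i)) = if k = l then c else 0 := fun k l => by
    have := congrArg (fun M : Matrix (Fin n) (Fin n) ℂ => M k l) hc
    simpa [Matrix.one_apply] using this
  -- The scalar is found from the trace of the matrix. Since `h` is tracial, `∑ₖ h(u_kj u_ki⋆) =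
  -- h(∑ₖ u_ki⋆ u_kj) = δ_ij`; this is where the Kac assumption removes the modular matrix from the
  -- relations.
  have htr : (n : ℂ) * c = if i = j then 1 else 0 := by
    have h1 : ∑ k, h (u k j * star (u k i)) = (n : ℂ) * c := by simp [hM]
    have h2 : ∑ k, h (u k j * star (u k i)) = h (∑ k, star (u k i) * u k j) := by
      rw [map_sum]
      exact Finset.sum_congr rfl fun k _ => ht _ _
    rw [← h1, h2, hu.sum_star_mul, apply_ite h.toLinearMap, h.map_one, map_zero]
  have hn : (n : ℂ) ≠ 0 := by exact_mod_cast hu.pos.ne'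
  have hc' : c = if i = j then (n : ℂ)⁻¹ else 0 := by
    rw [eq_comm, ← mul_right_inj' hn, htr]
    split_ifs <;> simp [hn]
  rw [hM, hc', ite_and]

/-- The computation `Δ⋆(ΣΔ(u_ij)) = δ_ij n⁻¹ χ_u` in weak form. With `ΣΔ(u_ij) = ∑ₖ u_kj ⊗ u_ik`,
slicing the second leg produces `∑ₗ h(u_lk y) u_li⋆`, and orthogonality keeps only `l = k`. -/
theorem IsIrreducibleCorep.tensor_flip_comul (hu : G.IsIrreducibleCorep u) (hH : G.IsHaarState h)
    (ht : h.IsTracial) (i j : Fin n) (y : A) :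
    h.tensor (flip A A (G.comul (u i j)) * G.comul y) =
      (if i = j then (n : ℂ)⁻¹ else 0) * h (u.trace * y) := by
  rw [hu.comul_apply, map_sum, Finset.sum_mul, State.tensor, map_sum, map_sum]
  have e : ∀ k, h (sliceRight A h (flip A A (tmul (u i k) (u k j)) * G.comul y)) =
      (if i = j then (n : ℂ)⁻¹ else 0) * h (u k k * y) := fun k => by
    rw [flip_tmul, tmul_eq_mul, mul_assoc, sliceRight_tmul_one_mul,
      hu.slice_one_tmul_mul_comul hH, Finset.mul_sum, map_sum]
    simp only [mul_smul_comm, map_smul, hu.haar_mul_star hH ht, smul_eq_mul]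
    rw [Finset.sum_eq_single k]
    · simp [mul_comm]
    · intro b _ hb
      simp [Ne.symm hb]
    · simp
  simp only [e, ← Finset.mul_sum, ← map_sum, ← Finset.sum_mul]
  rfl

end Corep

/-! ### Averaging polynomial elements to characters -/

theorem exists_characterSpan_tensor (hH : G.IsHaarState h) (ht : h.IsTracial) {p : A}
    (hp : p ∈ G.pol) : ∃ q ∈ G.characterSpan, ∀ y,
      h (q * y) = h.tensor (flip A A (G.comul p) * G.comul y) := by
  have hadd : ∀ x y, h.tensor (x + y) = h.tensor x + h.tensor y := fun x y => by
    simp [State.tensor]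
  induction hp using Submodule.span_induction with
  | mem p hp =>
    obtain ⟨n, u, i, j, hu, rfl⟩ := hp
    refine ⟨(if i = j then (n : ℂ)⁻¹ else 0) • u.trace,
      Submodule.smul_mem _ _ (Submodule.subset_span ⟨n, u, hu, rfl⟩), fun y => ?_⟩
    rw [hu.tensor_flip_comul hH ht, smul_mul_assoc, map_smul, smul_eq_mul]
  | zero => exact ⟨0, Submodule.zero_mem _, fun y => by simp [State.tensor]⟩
  | add p p' _ _ hp hp' =>
    obtain ⟨q, hq, e⟩ := hp
    obtain ⟨q', hq', e'⟩ := hp'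
    refine ⟨q + q', Submodule.add_mem _ hq hq', fun y => ?_⟩
    rw [add_mul, map_add, e, e', map_add, map_add, add_mul, hadd]
  | smul c p _ hp =>
    obtain ⟨q, hq, e⟩ := hp
    refine ⟨c • q, Submodule.smul_mem _ _ hq, fun y => ?_⟩
    rw [smul_mul_assoc, map_smul, e, map_smul, map_smul, smul_mul_assoc]
    simp [State.tensor]

/-- The map `Δ⋆ΣΔ` is contractive, fixes the central element `a` and sends `p` into the span of the
characters; it is applied here to `p - a`. That `q` can be chosen as close to `a` as `p` is what
serves both halves of the theorem. -/
theorem exists_characterSpan_norm_sub_le (R : h.GNSData) (hH : G.IsHaarState h) (ht : h.IsTracial)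
    (hf : h.IsFaithful) {p a : A} (hp : p ∈ G.pol) (ha : a ∈ G.central) :
    ∃ q ∈ G.characterSpan, ‖q - a‖ ≤ ‖p - a‖ := by
  obtain ⟨q, hq, e⟩ := G.exists_characterSpan_tensor hH ht hp
  refine ⟨q, hq, (G.norm_le_of_tensor_comul R hH ht hf
    (w := flip A A (G.comul (p - a))) fun y => ?_).trans ?_⟩
  · have ha' : flip A A (G.comul a) = G.comul a := (show G.comul a = flip A A (G.comul a) from ha).symm
    have hsub : ∀ x y, h.tensor (x - y) = h.tensor x - h.tensor y := fun x y => by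
      simp [State.tensor]
    rw [sub_mul, map_sub, map_sub, map_sub, sub_mul, hsub, ← e, ha', ← map_mul, hH.tensor_comul]
  · exact (NonUnitalStarAlgHom.norm_apply_le (flip A A) _).trans
      (NonUnitalStarAlgHom.norm_apply_le G.comul _)

theorem characterSpan_le_polCentral : G.characterSpan ≤ G.polCentral := by
  refine Submodule.span_le.mpr ?_
  rintro _ ⟨n, u, hu, rfl⟩
  refine ⟨Submodule.sum_mem _ fun i _ => Submodule.subset_span ⟨n, u, i, i, hu, rfl⟩, ?_⟩
  change G.comul u.trace = flip A A (G.comul u.trace)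
  simp only [Matrix.trace, Matrix.diag_apply, map_sum, hu.comul_apply, flip_tmul]
  rw [Finset.sum_comm]

theorem isClosed_central : IsClosed (G.central : Set A) :=
  isClosed_eq (continuous_hom G.comul) (continuous_hom ((flip A A).comp G.comul))

theorem polCentral_eq_characterSpan (R : h.GNSData) (hH : G.IsHaarState h) (ht : h.IsTracial)
    (hf : h.IsFaithful) : G.polCentral = G.characterSpan := by
  refine le_antisymm (fun a ha => ?_) G.characterSpan_le_polCentral
  -- Here `p = a`, so the bound is zero and forces `q = a`.
  obtain ⟨q, hq, e⟩ := G.exists_characterSpan_norm_sub_le R hH ht hf ha.1 ha.2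
  rw [sub_self, norm_zero, norm_le_zero_iff, sub_eq_zero] at e
  rwa [← e]

theorem closure_polCentral (R : h.GNSData) (hH : G.IsHaarState h) (ht : h.IsTracial) (hf : h.IsFaithful)
    (hd : Dense (G.pol : Set A)) : closure (G.polCentral : Set A) = (G.central : Set A) := by
  refine subset_antisymm (closure_minimal (fun a ha => ha.2) G.isClosed_central) fun a ha => ?_
  refine Metric.mem_closure_iff.mpr fun ε hε => ?_
  obtain ⟨p, hp, hpa⟩ := Metric.mem_closure_iff.mp (hd a) ε hε
  obtain ⟨q, hq, e⟩ := G.exists_characterSpan_norm_sub_le R hH ht hf hp ha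
  refine ⟨q, G.characterSpan_le_polCentral hq, ?_⟩
  rw [dist_comm, dist_eq_norm] at hpa ⊢
  exact e.trans_lt hpa

end CompactQuantumGroup

/-! ### Complete reducibility of unitary corepresentations -/

section ScalarMatrix

variable {n : ℕ}

theorem star_map_algebraMap (T : Matrix (Fin n) (Fin n) ℂ) :
    star (T.map (algebraMap ℂ A)) = (star T).map (algebraMap ℂ A) := by
  ext i j
  simp only [Matrix.star_apply, Matrix.map_apply]
  exact (algebraMap_star_comm (R := ℂ) (A := A) (T j i)).symm

theorem one_map_algebraMap :
    (1 : Matrix (Fin n) (Fin n) ℂ).map (algebraMap ℂ A) = 1 :=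
  Matrix.map_one _ (map_zero _) (map_one _)

theorem map_algebraMap_map (f : A →⋆ₐ[ℂ] B) (T : Matrix (Fin n) (Fin n) ℂ) :
    (T.map (algebraMap ℂ A)).map f = T.map (algebraMap ℂ B) := by
  ext i j
  simp only [Matrix.map_apply]
  exact AlgHomClass.commutes f _

end ScalarMatrix

namespace CompactQuantumGroup

variable {G : CompactQuantumGroup A} {n : ℕ} {u : Matrix (Fin n) (Fin n) A}

/-- The matrix form `Δ(u) = u₁₂ u₁₃` turns changes of basis into matrix algebra. -/
theorem comul_apply_iff :
    (∀ i j, G.comul (u i j) = ∑ k, tmul (u i k) (u k j)) ↔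
      u.map G.comul = u.map (inclLeft A A) * u.map (inclRight A A) := by
  rw [← Matrix.ext_iff]
  simp only [Matrix.map_apply, Matrix.mul_apply, inclLeft_apply, inclRight_apply, ← tmul_eq_mul]

/-- Scalar matrices are fixed by `Δ` and by both inclusions into `A ⊗ A`, so the factors `Q Q⋆` in
the middle of `u₁₂ u₁₃` cancel. -/
theorem IsUnitaryCorep.conj (hu : G.IsUnitaryCorep u) {Q : Matrix (Fin n) (Fin n) ℂ}
    (hQ : Q ∈ unitary (Matrix (Fin n) (Fin n) ℂ)) :
    G.IsUnitaryCorep ((star Q).map (algebraMap ℂ A) * u * Q.map (algebraMap ℂ A)) := by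
  constructor
  · have hQ' : Q.map (algebraMap ℂ A) ∈ unitary (Matrix (Fin n) (Fin n) A) := by
      constructor
      · rw [star_map_algebraMap, ← Matrix.map_mul, hQ.1, one_map_algebraMap]
      · rw [star_map_algebraMap, ← Matrix.map_mul, hQ.2, one_map_algebraMap]
    rw [← star_map_algebraMap]
    exact mul_mem (mul_mem (Unitary.star_mem hQ') hu.unitary_mem) hQ'
  · rw [comul_apply_iff]
    have h1 := comul_apply_iff.mp hu.comul_apply
    have h2 : Q.map (algebraMap ℂ (MinTensor A A)) * (star Q).map (algebraMap ℂ (MinTensor A A)) =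
        1 := by
      rw [← Matrix.map_mul, hQ.2, one_map_algebraMap]
    simp only [Matrix.map_mul, map_algebraMap_map, h1]
    simp only [mul_assoc]
    rw [← mul_assoc (Q.map _) ((star Q).map _), h2, one_mul]

/-- A block of a unitary corepresentation that is block diagonal with respect to the level sets
of a function. -/
theorem IsUnitaryCorep.block (hu : G.IsUnitaryCorep u) {X : Type*} (d : Fin n → X)
    (hd : ∀ i j, d i ≠ d j → u i j = 0) (c : X) {m : ℕ} (e : Fin m ≃ {i // d i = c}) :
    G.IsUnitaryCorep (Matrix.of fun a b => u (e a) (e b) : Matrix (Fin m) (Fin m) A) := by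
  have hinj : Function.Injective fun a => (e a : Fin n) :=
    Subtype.val_injective.comp e.injective
  have hrange : ∀ i, i ∉ Set.range (fun a => (e a : Fin n)) → d i ≠ c := fun i hi hc =>
    hi ⟨e.symm ⟨i, hc⟩, by simp⟩
  have h1 := hu.unitary_mem.1
  have h2 := hu.unitary_mem.2
  rw [← Matrix.ext_iff] at h1 h2
  refine ⟨⟨?_, ?_⟩, fun a b => ?_⟩
  · ext a b
    have := h1 (e a) (e b)
    rw [Matrix.mul_apply, Matrix.one_apply] at this ⊢
    simp only [hinj.eq_iff] at this
    rw [← this]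
    refine Fintype.sum_of_injective (fun a => (e a : Fin n)) hinj _ _ (fun i hi => ?_) fun _ => rfl
    rw [hd i (e b) (by rw [(e b).2]; exact hrange i hi), mul_zero]
  · ext a b
    have := h2 (e a) (e b)
    rw [Matrix.mul_apply, Matrix.one_apply] at this ⊢
    simp only [hinj.eq_iff] at this
    rw [← this]
    refine Fintype.sum_of_injective (fun a => (e a : Fin n)) hinj _ _ (fun i hi => ?_) fun _ => rfl
    rw [hd (e a) i (by rw [(e a).2]; exact (hrange i hi).symm), zero_mul]
  · rw [Matrix.of_apply, hu.comul_apply, eq_comm]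
    refine Fintype.sum_of_injective (fun a => (e a : Fin n)) hinj _ _ (fun i hi => ?_) fun _ => rfl
    rw [hd (e a) i (by rw [(e a).2]; exact (hrange i hi).symm)]
    simp [tmul]

/-- A reducible unitary corepresentation has a non-scalar Hermitian self-intertwiner. -/
theorem IsUnitaryCorep.exists_isHermitian (hu : G.IsUnitaryCorep u) (hn : 0 < n)
    (hirr : ¬ G.IsIrreducibleCorep u) : ∃ T : Matrix (Fin n) (Fin n) ℂ, T.IsHermitian ∧
      T.map (algebraMap ℂ A) * u = u * T.map (algebraMap ℂ A) ∧ ∀ c : ℂ, T ≠ c • 1 := by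
  by_contra! H
  refine hirr ⟨hu, hn, fun T hT => ?_⟩
  -- Intertwiners are closed under adjoints: take the adjoint of `hT`, then multiply by `u` on both
  -- sides and use unitarity.
  have hT' : (star T).map (algebraMap ℂ A) * u = u * (star T).map (algebraMap ℂ A) := by
    have h1 := congrArg star hT
    rw [star_mul, star_mul, star_map_algebraMap] at h1
    calc (star T).map (algebraMap ℂ A) * u
        = u * (star u * (star T).map (algebraMap ℂ A)) * u := by
          rw [← mul_assoc, hu.unitary_mem.2, one_mul]
      _ = u * (star T).map (algebraMap ℂ A) * (star u * u) := by
          rw [h1]; simp only [mul_assoc]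
      _ = _ := by rw [hu.unitary_mem.1, mul_one]
  have hmap : ∀ (S : Matrix (Fin n) (Fin n) ℂ) (c : ℂ), (c • S).map (algebraMap ℂ A) =
      c • S.map (algebraMap ℂ A) := fun S c => by
    ext i j
    simp [Algebra.algebraMap_eq_smul_one, mul_smul]
  -- Both `T + T⋆` and `i(T - T⋆)` are Hermitian intertwiners. If they are the scalars `c` and `d`,
  -- then `2T = c - i d`.
  obtain ⟨c, hc⟩ := H (T + star T) (by
    rw [Matrix.IsHermitian, ← Matrix.star_eq_conjTranspose, star_add, star_star, add_comm]) (by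
    rw [Matrix.map_add _ (map_add _), add_mul, mul_add, hT, hT'])
  obtain ⟨d, hd⟩ := H (Complex.I • (T - star T)) (by
    rw [Matrix.IsHermitian, ← Matrix.star_eq_conjTranspose, star_smul, star_sub, star_star]
    simp [smul_sub, neg_add_eq_sub]) (by
    rw [hmap, Matrix.map_sub _ (map_sub _), smul_mul_assoc, mul_smul_comm, sub_mul, mul_sub,
      hT, hT'])
  refine ⟨(c - Complex.I * d) / 2, ?_⟩
  have h3 : T - star T = (- Complex.I * d) • 1 := by
    rw [mul_smul, ← hd, smul_smul]
    simp
  have h4 : (2 : ℂ) • T = (c - Complex.I * d) • 1 := by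
    calc (2 : ℂ) • T = (T + star T) + (T - star T) := by rw [two_smul]; abel
      _ = _ := by rw [hc, h3, ← add_smul]; congr 1; ring
  rw [div_eq_inv_mul, mul_smul, ← h4, smul_smul]
  simp

/-- The coefficients of a unitary corepresentation are in `Pol(G)`. -/
theorem IsUnitaryCorep.apply_mem_pol (hu : G.IsUnitaryCorep u) (i j : Fin n) :
    u i j ∈ G.pol := by
  -- Induction on the dimension. A non-scalar Hermitian intertwiner, once diagonalised, splits `u`
  -- in a new basis into blocks indexed by its eigenvalues, each of smaller dimension; the entries
  -- of `u` are linear combinations of the entries of these blocks.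
  induction n using Nat.strong_induction_on with
  | _ n ih =>
  by_cases hirr : G.IsIrreducibleCorep u
  · exact Submodule.subset_span ⟨n, u, i, j, hirr, rfl⟩
  obtain ⟨T, hT, hTu, hns⟩ := hu.exists_isHermitian i.pos hirr
  set D : Matrix (Fin n) (Fin n) ℂ := Matrix.diagonal (RCLike.ofReal ∘ hT.eigenvalues) with hD
  obtain ⟨Q, hQ, hTD⟩ : ∃ Q ∈ unitary (Matrix (Fin n) (Fin n) ℂ), T = Q * D * star Q :=
    ⟨hT.eigenvectorUnitary.1, hT.eigenvectorUnitary.2,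
      hT.spectral_theorem.trans (Unitary.conjStarAlgAut_apply _ _)⟩
  have hQD : star Q * T = D * star Q := by
    rw [hTD, ← mul_assoc, ← mul_assoc, hQ.1, one_mul]
  have hQD' : T * Q = Q * D := by
    rw [hTD, mul_assoc, hQ.1, mul_one]
  set v := (star Q).map (algebraMap ℂ A) * u * Q.map (algebraMap ℂ A) with hv
  have hvc : G.IsUnitaryCorep v := hu.conj hQ
  have hDv : D.map (algebraMap ℂ A) * v = v * D.map (algebraMap ℂ A) := by
    rw [hv, ← mul_assoc, ← mul_assoc, ← Matrix.map_mul, ← hQD, Matrix.map_mul,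
      mul_assoc _ (T.map _), hTu, mul_assoc _ (Q.map _), ← Matrix.map_mul, ← hQD',
      Matrix.map_mul]
    simp only [mul_assoc]
  -- Entrywise, `D v = v D` reads `(λ_i - λ_j) v_ij = 0`.
  have hv0 : ∀ i j, hT.eigenvalues i ≠ hT.eigenvalues j → v i j = 0 := by
    intro i j hij
    have h1 := congrArg (fun M : Matrix (Fin n) (Fin n) A => M i j) hDv
    have hDm : D.map (algebraMap ℂ A) =
        Matrix.diagonal fun i => algebraMap ℂ A (hT.eigenvalues i : ℂ) := by
      rw [hD, Matrix.diagonal_map (map_zero _)]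
      rfl
    simp only [hDm, Matrix.diagonal_mul, Matrix.mul_diagonal, ← Algebra.smul_def,
      ← Algebra.commutes] at h1
    rw [← sub_eq_zero, ← sub_smul, smul_eq_zero, sub_eq_zero] at h1
    exact h1.resolve_left fun h => hij (by exact_mod_cast h)
  have hvp : ∀ a b, v a b ∈ G.pol := by
    intro a b
    by_cases hab : hT.eigenvalues a = hT.eigenvalues b
    · set m := Fintype.card {i // hT.eigenvalues i = hT.eigenvalues a} with hm
      -- A block of full size would mean a single eigenvalue, and `T` would be scalar.
      have hlt : m < n := by
        by_contra hmn
        have hall : ∀ i, hT.eigenvalues i = hT.eigenvalues a := by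
          by_contra! hne
          obtain ⟨i, hi⟩ := hne
          refine hmn ?_
          have := Fintype.card_subtype_lt (p := fun i => hT.eigenvalues i = hT.eigenvalues a) hi
          simpa using this
        refine hns (hT.eigenvalues a) ?_
        have hDc : D = (hT.eigenvalues a : ℂ) • 1 := by
          rw [hD, Matrix.smul_one_eq_diagonal]
          congr 1
          funext i
          simp [hall i]
        exact hTD.trans (by rw [hDc, mul_smul_comm, smul_mul_assoc, mul_one, hQ.2])
      let e : Fin m ≃ {i // hT.eigenvalues i = hT.eigenvalues a} := (Fintype.equivFin _).symm
      have := ih m hlt (hvc.block hT.eigenvalues hv0 _ e) (e.symm ⟨a, rfl⟩) (e.symm ⟨b, hab.symm⟩)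
      simpa using this
    · rw [hv0 a b hab]
      exact Submodule.zero_mem _
  have huv : u = Q.map (algebraMap ℂ A) * v * (star Q).map (algebraMap ℂ A) := by
    have h1 : Q.map (algebraMap ℂ A) * (star Q).map (algebraMap ℂ A) = 1 := by
      rw [← Matrix.map_mul, hQ.2, one_map_algebraMap]
    rw [hv, ← mul_assoc, ← mul_assoc, h1, one_mul, mul_assoc, h1, mul_one]
  rw [huv, Matrix.mul_apply]
  refine Submodule.sum_mem _ fun b _ => ?_
  rw [Matrix.mul_apply, Finset.sum_mul]
  refine Submodule.sum_mem _ fun a _ => ?_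
  simp only [Matrix.map_apply]
  rw [← Algebra.commutes, ← Algebra.smul_def, ← Algebra.smul_def]
  exact Submodule.smul_mem _ _ (Submodule.smul_mem _ _ (hvp a b))

end CompactQuantumGroup

/-! ### Reassociation on vectors, naturality of slices, and operators on one leg -/

namespace MinTensor

/-- The associativity homomorphism is implemented by rebracketing vectors. Coassociativity can
thereby be used at the level of matrix coefficients, with no need for `assoc` to be injective. -/
theorem inner_rep_assoc {π : HilbertRep A} {ρ : HilbertRep B} {σ : HilbertRep C}
    (ξ ξ' : π.space) (η η' : ρ.space) (θ θ' : σ.space) (x : MinTensor (MinTensor A B) C) :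
    ⟪(rvec (rvec ξ η) θ : (rep (rep π ρ) σ).space),
      (rep (rep π ρ) σ).hom x (rvec (rvec ξ' η') θ')⟫_ℂ =
    ⟪(rvec ξ (rvec η θ) : (rep π (rep ρ σ)).space),
      (rep π (rep ρ σ)).hom (assoc A B C x) (rvec ξ' (rvec η' θ'))⟫_ℂ := by
  refine isClosed_property (p := fun x => ⟪(rvec (rvec ξ η) θ : (rep (rep π ρ) σ).space),
      (rep (rep π ρ) σ).hom x (rvec (rvec ξ' η') θ')⟫_ℂ =
    ⟪(rvec ξ (rvec η θ) : (rep π (rep ρ σ)).space),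
      (rep π (rep ρ σ)).hom (assoc A B C x) (rvec ξ' (rvec η' θ'))⟫_ℂ) denseRange_of ?_
    (fun x => ?_) x
  · exact isClosed_eq (continuous_const.inner (continuous_hom_apply _ _))
      (continuous_const.inner ((continuous_hom_apply _ _).comp (continuous_hom (assoc A B C))))
  · rw [assoc, lift_of]
    exact inner_rep_algAssoc (ξ, η, θ) (ξ', η', θ') x

theorem map_sliceRight (f : A →⋆ₐ[ℂ] B) (h : State C) (z : MinTensor A C) :
    f (sliceRight A h z) = sliceRight B h (map f (.id ℂ C) z) := by
  have h1 := continuous_hom f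
  have h2 := continuous_hom (map f (.id ℂ C))
  refine induction_tmul (p := fun z => f (sliceRight A h z) =
    sliceRight B h (map f (.id ℂ C) z)) ?_ ?_ ?_ ?_ z
  · apply isClosed_eq <;> fun_prop
  · simp
  · intro x y hx hy
    simp only [map_add, hx, hy]
  · intro a c
    rw [map_tmul, sliceRight_tmul, sliceRight_tmul, map_smul]
    rfl

end MinTensor

/-- The operator `1 ⊗ S`. -/
def idTensor {π : HilbertRep A} {ρ : HilbertRep B} (S : ρ.space →L[ℂ] ρ.space) :
    (MinTensor.rep π ρ).space →L[ℂ] (MinTensor.rep π ρ).space :=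
  (opTensor 1 S : HilbertTensor π.space ρ.space →L[ℂ] HilbertTensor π.space ρ.space)

section IdTensor

variable {π : HilbertRep A} {ρ : HilbertRep B}

theorem idTensor_rvec (S : ρ.space →L[ℂ] ρ.space) (x : π.space) (y : ρ.space) :
    idTensor S (rvec x y : (MinTensor.rep π ρ).space) = rvec x (S y) :=
  opTensor_htmul 1 S x y

theorem inner_idTensor_left (S : ρ.space →L[ℂ] ρ.space) (v w : (MinTensor.rep π ρ).space) :
    ⟪idTensor S v, w⟫_ℂ = ⟪v, idTensor (ContinuousLinearMap.adjoint S) w⟫_ℂ := by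
  have h1 := opTensor_star (1 : π.space →L[ℂ] π.space) S
  rw [star_one, ContinuousLinearMap.star_eq_adjoint, ContinuousLinearMap.star_eq_adjoint] at h1
  have h2 : (idTensor (ContinuousLinearMap.adjoint S) :
      (MinTensor.rep π ρ).space →L[ℂ] (MinTensor.rep π ρ).space) =
      ContinuousLinearMap.adjoint (idTensor S) := h1.symm
  rw [h2, ContinuousLinearMap.adjoint_inner_right]

theorem idTensor_comp (S T : ρ.space →L[ℂ] ρ.space) (v : (MinTensor.rep π ρ).space) :
    idTensor (S.comp T) v = idTensor S (idTensor T v) := by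
  have h1 := opTensor_mul (1 : π.space →L[ℂ] π.space) 1 S T
  rw [one_mul] at h1
  exact (congrArg (fun L : HilbertTensor π.space ρ.space →L[ℂ] HilbertTensor π.space ρ.space =>
    L v) h1).symm

end IdTensor

/-! ### Compact convolution operators commuting with translation -/

namespace CompactQuantumGroup

variable (G : CompactQuantumGroup A) {h : State A} (R : h.GNSData)

variable (h) in
/-- The convolution operator `x ↦ (id ⊗ h)(z Δ(x))`. -/
def conv (z : MinTensor A A) : A →ₗ[ℂ] A :=
  (sliceRight A h).toLinearMap ∘ₗ LinearMap.mulLeft ℂ z ∘ₗ G.comul.toAlgHom.toLinearMap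

theorem conv_apply (z : MinTensor A A) (x : A) :
    G.conv h z x = sliceRight A h (z * G.comul x) := rfl

/-- A smoothing bound: `Δ(x)(η ⊗ Ω)` has norm `‖η‖ ‖xΩ‖`, so the C⋆-norm of the convolution is
controlled by the GNS norm of `x`. Hence convolution extends to the whole GNS space with values
still in `A`. -/
theorem norm_conv_le (hH : G.IsHaarState h) (hf : h.IsFaithful) (z : MinTensor A A) (x : A) :
    ‖G.conv h z x‖ ≤ ‖z‖ * ‖R.emb x‖ := by
  refine R.norm_le_of_inner_emb hf (by positivity) fun c d => ?_
  rw [conv_apply, ← R.inner_rvec_vec_rep]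
  calc _ ≤ ‖(rvec (R.emb d) R.vec : R.tensorRep.space)‖ *
        ‖R.tensorRep.hom (z * G.comul x) (rvec (R.emb c) R.vec)‖ := norm_inner_le_norm _ _
    _ ≤ ‖(rvec (R.emb d) R.vec : R.tensorRep.space)‖ *
        (‖z‖ * ‖R.tensorRep.hom (G.comul x) (rvec (R.emb c) R.vec)‖) := by
        gcongr
        rw [hom_mul_apply]
        exact ((R.tensorRep.hom z).le_opNorm _).trans
          (mul_le_mul_of_nonneg_right (norm_hom_le _ z) (norm_nonneg _))
    _ = _ := by rw [norm_rvec, R.norm_vec, G.norm_comul_rvec R hH]; ring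

/-- The convolution operator as a bounded operator from the GNS space to `A`. -/
def convL (z : MinTensor A A) : R.rep.space →L[ℂ] A :=
  (G.conv h z).extendOfNorm R.emb.toLinearMap

theorem convL_emb (hH : G.IsHaarState h) (hf : h.IsFaithful) (z : MinTensor A A) (x : A) :
    G.convL R z (R.emb x) = G.conv h z x :=
  LinearMap.extendOfNorm_eq (e := R.emb.toLinearMap) R.denseRange_emb
    ⟨‖z‖, G.norm_conv_le R hH hf z⟩ x

theorem norm_convL_le (hH : G.IsHaarState h) (hf : h.IsFaithful) (z : MinTensor A A) :
    ‖G.convL R z‖ ≤ ‖z‖ :=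
  ContinuousLinearMap.opNorm_le_bound _ (norm_nonneg _) fun x =>
    LinearMap.norm_extendOfNorm_apply_le (e := R.emb.toLinearMap) R.denseRange_emb _
      (G.norm_conv_le R hH hf z) x

theorem ext_emb {E : Type*} [NormedAddCommGroup E] [NormedSpace ℂ E] {S T : R.rep.space →L[ℂ] E}
    (H : ∀ x, S (R.emb x) = T (R.emb x)) : S = T :=
  ContinuousLinearMap.ext fun v => congrFun (R.denseRange_emb.equalizer S.continuous T.continuous
    (funext H)) v

theorem dense_span_star {E : Type*} [CStarAlgebra E] {s t : Set E}
    (hs : Dense (Submodule.span ℂ s : Set E)) (hst : ∀ x ∈ s, star x ∈ t) :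
    Dense (Submodule.span ℂ t : Set E) := by
  refine ((star_involutive (R := E)).surjective.denseRange.dense_image continuous_star hs).mono ?_
  rintro _ ⟨x, hx, rfl⟩
  induction hx using Submodule.span_induction with
  | mem x hx => exact Submodule.subset_span (hst x hx)
  | zero => rw [star_zero]; exact Submodule.zero_mem _
  | add x y _ _ hx hy => rw [star_add]; exact Submodule.add_mem _ hx hy
  | smul c x _ hx => rw [star_smul]; exact Submodule.smul_mem _ _ hx

/-- For `z = (b ⊗ 1)Δ(a)` invariance makes the operator `x ↦ h(ax) b`, of rank at most one. Such `z`
span a dense subspace by the adjoint of the cancellation property, and compact operators form a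
norm-closed set. -/
theorem isCompactOperator_convL (hH : G.IsHaarState h) (hf : h.IsFaithful) (z : MinTensor A A) :
    IsCompactOperator (G.convL R z) := by
  let Φ : MinTensor A A →L[ℂ] R.rep.space →L[ℂ] A := LinearMap.mkContinuous
    { toFun := G.convL R
      map_add' := fun z w => ext_emb R fun x => by
        simp only [add_apply, G.convL_emb R hH hf, conv_apply, add_mul, map_add]
      map_smul' := fun c z => ext_emb R fun x => by
        simp only [smul_apply, G.convL_emb R hH hf, conv_apply, smul_mul_assoc, map_smul,
          RingHom.id_apply] } 1 fun z => (G.norm_convL_le R hH hf z).trans_eq (one_mul _).symm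
  have hd : Dense (Submodule.span ℂ {x | ∃ a b : A, x = tmul b 1 * G.comul a} :
      Set (MinTensor A A)) := dense_span_star G.dense_right (by
    rintro _ ⟨a, b, rfl⟩
    exact ⟨star a, star b, by rw [star_mul, star_tmul, star_one, map_star]⟩)
  have hcl : IsClosed {z | IsCompactOperator (Φ z)} :=
    isClosed_setOfPred_isCompactOperator.preimage Φ.continuous
  refine hd.induction (P := fun z => IsCompactOperator (Φ z)) (fun z hz => ?_) hcl z
  induction hz using Submodule.span_induction with
  | mem z hz =>
    obtain ⟨a, b, rfl⟩ := hz
    have e : Φ (tmul b 1 * G.comul a) = (ContinuousLinearMap.toSpanSingleton ℂ b).comp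
        (innerSL ℂ (R.emb (star a))) := ext_emb R fun x => by
      refine (G.convL_emb R hH hf _ x).trans ?_
      rw [conv_apply, mul_assoc, ← map_mul, sliceRight_tmul_one_mul, hH.sliceRight_comul,
        mul_smul_comm, mul_one]
      simp [R.inner_emb]
    rw [e]
    exact (isCompactOperator_of_locallyCompactSpace_rng
      (ContinuousLinearMap.toSpanSingleton ℂ b)).comp_clm _
  | zero => rw [map_zero]; exact isCompactOperator_zero
  | add x y _ _ hx hy => rw [map_add]; exact hx.add hy
  | smul c x _ hx => rw [map_smul]; exact hx.smul c

/-- The convolution operator `x ↦ (id ⊗ h)((1 ⊗ a) Δ(x))` on the GNS space. -/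
def convOp (a : A) : R.rep.space →L[ℂ] R.rep.space := R.emb.comp (G.convL R (tmul 1 a))

theorem convOp_emb (hH : G.IsHaarState h) (hf : h.IsFaithful) (a x : A) :
    G.convOp R a (R.emb x) = R.emb (G.conv h (tmul 1 a) x) := by
  rw [convOp, ContinuousLinearMap.comp_apply, G.convL_emb R hH hf]

theorem inner_map_id_comul (hH : G.IsHaarState h) (hf : h.IsFaithful) (ξ ξ' θ : R.rep.space) (a : A)
    (y : MinTensor A A) :
    ⟪(rvec ξ (rvec θ (R.emb (star a))) : (rep R.rep R.tensorRep).space),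
      (rep R.rep R.tensorRep).hom (map (.id ℂ A) G.comul y) (rvec ξ' R.tensorVec)⟫_ℂ =
    ⟪(rvec ξ θ : R.tensorRep.space),
      idTensor (G.convOp R a) (R.tensorRep.hom y (rvec ξ' R.vec))⟫_ℂ := by
  refine induction_tmul (p := fun y =>
    ⟪(rvec ξ (rvec θ (R.emb (star a))) : (rep R.rep R.tensorRep).space),
      (rep R.rep R.tensorRep).hom (map (.id ℂ A) G.comul y) (rvec ξ' R.tensorVec)⟫_ℂ =
    ⟪(rvec ξ θ : R.tensorRep.space),
      idTensor (G.convOp R a) (R.tensorRep.hom y (rvec ξ' R.vec))⟫_ℂ) ?_ ?_ ?_ ?_ y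
  · exact isClosed_eq (continuous_const.inner ((continuous_hom_apply _ _).comp (continuous_hom _)))
      (continuous_const.inner ((ContinuousLinearMap.continuous _).comp (continuous_hom_apply _ _)))
  · simp
  · intro x y hx hy
    simp only [map_add, add_apply, inner_add_right, hx, hy]
  · intro s t
    rw [map_tmul, rep_tmul_rvec, rep_tmul_rvec, idTensor_rvec, inner_rvec, inner_rvec,
      R.inner_rvec_emb_rep, star_star, ← R.emb_apply, ← R.emb_apply, G.convOp_emb R hH hf,
      conv_apply]
    rfl

/-- Coassociativity in the form `Δ(K_a x) = (id ⊗ K_a)Δ(x)`: apply `Δ` to the leg that is not sliced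
and move the brackets. -/
theorem comul_conv (hH : G.IsHaarState h) (hf : h.IsFaithful) (a x : A) (ξ : R.rep.space) :
    R.tensorRep.hom (G.comul (G.conv h (tmul 1 a) x)) (rvec ξ R.vec) =
      idTensor (G.convOp R a) (R.tensorRep.hom (G.comul x) (rvec ξ R.vec)) := by
  refine R.ext_inner_rvec fun η θ => ?_
  have e : G.comul (G.conv h (tmul 1 a) x) = sliceRight (MinTensor A A) h
      (tmul 1 (star (star a)) * map G.comul (.id ℂ A) (G.comul x)) := by
    rw [conv_apply, map_sliceRight, map_mul, map_tmul, map_one, star_star]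
    rfl
  rw [e, ← R.inner_rvec_emb_rep, inner_rep_assoc, G.coassoc, ← G.inner_map_id_comul R hH hf]

/-- The isometry of GNS spaces induced by the comultiplication. -/
def comulL : R.rep.space →L[ℂ] R.tensorRep.space :=
  LinearMap.extendOfNorm ((ContinuousLinearMap.apply ℂ R.tensorRep.space R.tensorVec).toLinearMap ∘ₗ
    R.tensorRep.hom.toAlgHom.toLinearMap ∘ₗ G.comul.toAlgHom.toLinearMap) R.emb.toLinearMap

theorem comulL_emb (hH : G.IsHaarState h) (x : A) :
    G.comulL R (R.emb x) = R.tensorRep.hom (G.comul x) R.tensorVec :=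
  LinearMap.extendOfNorm_eq (e := R.emb.toLinearMap) R.denseRange_emb ⟨1, fun x => by
    refine (G.norm_comul_rvec R hH R.vec x).le.trans_eq ?_
    rw [R.norm_vec]
    rfl⟩ x

theorem inner_comulL (hH : G.IsHaarState h) (η ξ : R.rep.space) (d : A) :
    ⟪R.tensorRep.hom (G.comul d) (rvec η R.vec), G.comulL R ξ⟫_ℂ =
      ⟪η, R.vec⟫_ℂ * ⟪R.emb d, ξ⟫_ℂ := by
  refine isClosed_property (p := fun ξ =>
    ⟪R.tensorRep.hom (G.comul d) (rvec η R.vec), G.comulL R ξ⟫_ℂ =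
      ⟪η, R.vec⟫_ℂ * ⟪R.emb d, ξ⟫_ℂ) R.denseRange_emb ?_ (fun y => ?_) ξ
  · apply isClosed_eq <;> fun_prop
  · rw [G.comulL_emb R hH, G.inner_comul R hH]

/-- The isometry of `inner_comul` has dense range, because `Δ(A)(A ⊗ 1)` spans a dense subspace of
`A ⊗ A`. -/
theorem ext_inner_comul {v w : R.tensorRep.space}
    (H : ∀ d c, ⟪R.tensorRep.hom (G.comul d) (rvec (R.emb c) R.vec), v⟫_ℂ =
      ⟪R.tensorRep.hom (G.comul d) (rvec (R.emb c) R.vec), w⟫_ℂ) : v = w := by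
  have key : ∀ z, ⟪R.tensorRep.hom z R.tensorVec, v⟫_ℂ = ⟪R.tensorRep.hom z R.tensorVec, w⟫_ℂ := by
    refine G.dense_right.induction (P := fun z => ⟪R.tensorRep.hom z R.tensorVec, v⟫_ℂ =
      ⟪R.tensorRep.hom z R.tensorVec, w⟫_ℂ) (fun z hz => ?_) ?_
    · induction hz using Submodule.span_induction with
      | mem z hz =>
        obtain ⟨d, c, rfl⟩ := hz
        rw [hom_mul_apply, R.rep_tmul_vec, R.emb_one]
        exact H d c
      | zero => simp
      | add x y _ _ hx hy => simp only [map_add, add_apply, inner_add_left, hx, hy]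
      | smul c x _ hx => simp only [map_smul, smul_apply, inner_smul_left, hx]
    · have := continuous_hom_apply R.tensorRep R.tensorVec
      exact isClosed_eq (this.inner continuous_const) (this.inner continuous_const)
  exact R.ext_inner_rvec_emb fun b d => by
    rw [← R.rep_tmul_vec]
    exact key _

theorem comulL_convOp (hH : G.IsHaarState h) (hf : h.IsFaithful) (a : A) (ξ : R.rep.space) :
    G.comulL R (G.convOp R a ξ) = idTensor (G.convOp R a) (G.comulL R ξ) := by
  refine isClosed_property (p := fun ξ => G.comulL R (G.convOp R a ξ) =
    idTensor (G.convOp R a) (G.comulL R ξ)) R.denseRange_emb ?_ (fun y => ?_) ξ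
  · apply isClosed_eq <;> fun_prop
  · rw [G.convOp_emb R hH hf, G.comulL_emb R hH, G.comulL_emb R hH, G.comul_conv R hH hf]

/-- Intertwining `K` does not by itself give intertwining of `K⋆`. Testing against the total vectors
`Δ(d)(η ⊗ Ω)` moves `1 ⊗ K⋆` onto them, where `comul_conv` turns it into `Δ(K d)(η ⊗ Ω)`; both sides
become `⟪η, Ω⟫ ⟪K(dΩ), ξ⟫`. -/
theorem comulL_adjoint_convOp (hH : G.IsHaarState h) (hf : h.IsFaithful) (a : A)
    (ξ : R.rep.space) : G.comulL R (ContinuousLinearMap.adjoint (G.convOp R a) ξ) =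
      idTensor (ContinuousLinearMap.adjoint (G.convOp R a)) (G.comulL R ξ) := by
  refine G.ext_inner_comul R fun d c => ?_
  rw [← inner_idTensor_left, ← G.comul_conv R hH hf, G.inner_comulL R hH, G.inner_comulL R hH,
    ContinuousLinearMap.adjoint_inner_right, G.convOp_emb R hH hf]

/-- The positive convolution operator `K K⋆`. -/
def convSq (a : A) : R.rep.space →L[ℂ] R.rep.space :=
  (G.convOp R a).comp (ContinuousLinearMap.adjoint (G.convOp R a))

theorem comulL_convSq (hH : G.IsHaarState h) (hf : h.IsFaithful) (a : A) (ξ : R.rep.space) :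
    G.comulL R (G.convSq R a ξ) = idTensor (G.convSq R a) (G.comulL R ξ) := by
  rw [convSq, idTensor_comp, ← G.comulL_adjoint_convOp R hH hf, ← G.comulL_convOp R hH hf]
  rfl

theorem isCompactOperator_convSq (hH : G.IsHaarState h) (hf : h.IsFaithful) (a : A) :
    IsCompactOperator (G.convSq R a) :=
  ((G.isCompactOperator_convL R hH hf _).clm_comp R.emb).comp_clm
    (ContinuousLinearMap.adjoint (G.convOp R a))

theorem convSq_isSymmetric (a : A) : (G.convSq R a).IsSymmetric :=
  (ContinuousLinearMap.isPositive_self_comp_adjoint (G.convOp R a)).isSymmetric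

end CompactQuantumGroup

/-! ### From eigenspaces to unitary corepresentations -/

/-- Matrices over a C⋆-algebra with a faithful trace form a finite algebra. -/
theorem State.IsFaithful.star_mul_self_of_mul_star_self {h : State A} (hf : h.IsFaithful)
    (ht : h.IsTracial) {n : ℕ} {v : Matrix (Fin n) (Fin n) A} (hv : v * star v = 1) :
    star v * v = 1 := by
  -- `p` is a projection, and its trace is `n - n = 0` because `∑ h((v⋆v)_jj) = ∑ h((vv⋆)_ii) = n`.
  -- Faithfulness gives `p = 0`.
  set p := 1 - star v * v with hp
  have hpp : star p * p = p := by
    have h1 : star v * v * (star v * v) = star v * v := by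
      rw [mul_assoc, ← mul_assoc v, hv, one_mul]
    rw [hp, star_sub, star_one, star_mul, star_star, sub_mul, mul_sub, mul_sub, h1]
    simp
  have htr : ∑ j, h (p j j) = 0 := by
    have h1 : ∀ j, h (p j j) = 1 - ∑ i, h (v i j * star (v i j)) := fun j => by
      rw [hp, Matrix.sub_apply, Matrix.one_apply_eq, Matrix.mul_apply, map_sub, h.map_one, map_sum]
      refine congrArg _ (Finset.sum_congr rfl fun i _ => ?_)
      rw [Matrix.star_apply, ht]
    have h2 : ∀ i, ∑ j, h (v i j * star (v i j)) = 1 := fun i => by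
      have := congrArg (fun M : Matrix (Fin n) (Fin n) A => h (M i i)) hv
      simpa [Matrix.mul_apply, h.map_one, Matrix.star_apply] using this
    simp only [h1, Finset.sum_sub_distrib]
    rw [Finset.sum_comm]
    simp [h2]
  have h3 : ∀ j, h (p j j) = ∑ i, h (star (p i j) * p i j) := fun j => by
    conv_lhs => rw [← hpp]
    rw [Matrix.mul_apply, map_sum]
    rfl
  have h4 : p = 0 := by
    ext i j
    simp only [h3] at htr
    have h5 := (Finset.sum_eq_zero_iff_of_nonneg
      (fun j _ => Finset.sum_nonneg fun i _ => h.nonneg (p i j))).mp htr j (Finset.mem_univ j)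
    exact hf _ ((Finset.sum_eq_zero_iff_of_nonneg fun i _ => h.nonneg (p i j)).mp h5 i
      (Finset.mem_univ i))
  exact (sub_eq_zero.mp h4).symm

/-- A vector orthogonal to the eigenspaces of non-zero eigenvalues of a compact symmetric operator
is in its kernel. -/
theorem apply_eq_zero_of_inner_eigenspace {H : Type*} [NormedAddCommGroup H]
    [InnerProductSpace ℂ H] [CompleteSpace H] {T : H →L[ℂ] H} (hT : IsCompactOperator T)
    (hT' : T.IsSymmetric) {ξ : H}
    (hξ : ∀ μ : ℂ, μ ≠ 0 → ∀ x, T x = μ • x → ⟪x, ξ⟫_ℂ = 0) : T ξ = 0 := by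
  -- `Tξ` is orthogonal to every eigenspace: by hypothesis if `μ ≠ 0`, by symmetry of `T` if `μ =
  -- 0`. The spectral theorem for compact symmetric operators says that these span a dense subspace.
  have h1 : T ξ ∈ (⨆ μ, Module.End.eigenspace (T : Module.End ℂ H) μ)ᗮ := by
    rw [← Submodule.iInf_orthogonal, Submodule.mem_iInf]
    refine fun μ => (Submodule.mem_orthogonal _ _).mpr fun x hx => ?_
    have hx' : T x = μ • x := Module.End.mem_eigenspace_iff.mp hx
    have h2 : ⟪x, T ξ⟫_ℂ = ⟪T x, ξ⟫_ℂ := (hT' x ξ).symm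
    rw [h2, hx', inner_smul_left]
    by_cases hμ : μ = 0
    · simp [hμ]
    · rw [hξ μ hμ x hx', mul_zero]
  rwa [ContinuousLinearMap.orthogonalComplement_iSup_eigenspaces_eq_bot hT hT',
    Submodule.mem_bot] at h1

namespace CompactQuantumGroup

variable (G : CompactQuantumGroup A) {h : State A} (R : h.GNSData)

/-- A substitute for injectivity of `assoc`: the matrix coefficients of the slices see `x` and `y`
only through their images under `assoc`, and these coefficients determine elements of `A ⊗ A`
because `Ω ⊗ Ω` is separating. -/
theorem sliceRight_eq_of_assoc_eq (R : h.GNSData) (ht : h.IsTracial) (hf : h.IsFaithful) (b : A)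
    {x y : MinTensor (MinTensor A A) A} (hxy : assoc A A A x = assoc A A A y) :
    sliceRight (MinTensor A A) h (tmul 1 b * x) = sliceRight (MinTensor A A) h (tmul 1 b * y) := by
  refine R.eq_of_rep_tensorVec hf ht (R.ext_inner_rvec fun ξ η => ?_)
  have h1 := R.inner_rvec_emb_rep R.tensorRep (rvec ξ η) R.tensorVec (star b)
  rw [star_star] at h1
  rw [← h1, ← h1, inner_rep_assoc, inner_rep_assoc, hxy]

/-- Applying `id ⊗ h` to `Δ(ε_i ε_j⋆)` gives `v v⋆ = 1`; the trace property is what makes the `ε_k⋆`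
orthonormal too. The relation `v⋆ v = 1` then follows from finiteness of matrices over `A`. The
formula for `Δ(v_jm)` is the coefficient of `ε_m` in the coassociativity identity for `ε_j`. -/
theorem isUnitaryCorep_of_orthonormal (R : h.GNSData) (hH : G.IsHaarState h) (ht : h.IsTracial)
    (hf : h.IsFaithful) {n : ℕ} {ε : Fin n → A} {v : Matrix (Fin n) (Fin n) A}
    (hε : ∀ i j, h (star (ε i) * ε j) = if i = j then 1 else 0)
    (hv : ∀ j, G.comul (ε j) = ∑ k, tmul (v j k) (ε k)) : G.IsUnitaryCorep v := by
  have h1 : v * star v = 1 := by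
    ext i j
    have e1 := hH.sliceRight_comul (ε i * star (ε j))
    rw [ht, hε, map_mul, map_star, hv, hv, star_sum, Finset.sum_mul_sum, map_sum] at e1
    simp only [map_sum, star_tmul, tmul_mul_tmul, sliceRight_tmul, ht (ε _), hε] at e1
    rw [Matrix.mul_apply, Matrix.one_apply]
    simpa [Matrix.star_apply, eq_comm] using e1
  refine ⟨⟨hf.star_mul_self_of_mul_star_self ht h1, h1⟩, fun j m => ?_⟩
  have e1 : assoc A A A (map G.comul (.id ℂ A) (G.comul (ε j))) =
      assoc A A A (∑ k, tmul (∑ l, tmul (v j l) (v l k)) (ε k)) := by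
    rw [G.coassoc, hv, map_sum, map_sum]
    simp only [map_tmul, hv, sum_tmul, map_sum, assoc_tmul]
    rw [Finset.sum_comm]
    refine Finset.sum_congr rfl fun l _ => ?_
    simp only [StarAlgHom.coe_id, id_eq, tmul, TensorProduct.tmul_sum, map_sum]
  have e2 := sliceRight_eq_of_assoc_eq R ht hf (star (ε m)) e1
  rw [hv, map_sum] at e2
  simp only [map_tmul, Finset.mul_sum, tmul_mul_tmul, one_mul, map_sum, sliceRight_tmul,
    StarAlgHom.coe_id, id_eq, hε] at e2
  simpa using e2

theorem exists_corep_eigenspace (hH : G.IsHaarState h) (ht : h.IsTracial) (hf : h.IsFaithful)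
    (a : A) {μ : ℂ} (hμ : μ ≠ 0) :
    ∃ (n : ℕ) (ε : Fin n → A) (v : Matrix (Fin n) (Fin n) A), G.IsUnitaryCorep v ∧
      (∀ j, G.comul (ε j) = ∑ k, tmul (v j k) (ε k)) ∧
      ∀ x, G.convSq R a x = μ • x → x ∈ Submodule.span ℂ (Set.range fun j => R.emb (ε j)) := by
  set T := G.convSq R a with hT
  set E := Module.End.eigenspace T.toLinearMap μ with hE
  have hmem : ∀ x, x ∈ E ↔ T x = μ • x := fun x => Module.End.mem_eigenspace_iff
  have : FiniteDimensional ℂ E := ContinuousLinearMap.finite_dimensional_eigenspace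
    (G.isCompactOperator_convSq R hH hf a) μ hμ
  let e := stdOrthonormalBasis ℂ E
  -- An eigenvector `x` of `K K⋆` equals `μ⁻¹ K(K⋆x)`, and `K` factors through `A`. This is why `K
  -- K⋆` is used: its eigenvectors come from elements of the algebra.
  let ε : Fin (Module.finrank ℂ E) → A := fun j =>
    μ⁻¹ • G.convL R (tmul 1 a) (ContinuousLinearMap.adjoint (G.convOp R a) (e j : R.rep.space))
  have hemb : ∀ j, R.emb (ε j) = e j := fun j => by
    have h1 : T (e j) = μ • (e j : R.rep.space) := (hmem _).mp (e j).2
    have h2 : R.emb (ε j) = μ⁻¹ • T (e j) := map_smul R.emb _ _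
    rw [h2, h1, smul_smul, inv_mul_cancel₀ hμ, one_smul]
  have hε : ∀ i j, h (star (ε i) * ε j) = if i = j then 1 else 0 := fun i j => by
    rw [← R.inner_emb, hemb, hemb, ← Submodule.coe_inner]
    exact orthonormal_iff_ite.mp e.orthonormal i j
  let v : Matrix (Fin (Module.finrank ℂ E)) (Fin (Module.finrank ℂ E)) A := Matrix.of fun j k =>
    sliceRight A h (tmul 1 (star (ε k)) * G.comul (ε j))
  have hexp : ∀ x, T x = μ • x → x = ∑ k, ⟪(e k : R.rep.space), x⟫_ℂ • (e k : R.rep.space) := by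
    intro x hx
    have h1 := congrArg (Subtype.val) (e.sum_repr' ⟨x, (hmem x).mpr hx⟩)
    simpa using h1.symm
  have hv : ∀ j, G.comul (ε j) = ∑ k, tmul (v j k) (ε k) := by
    intro j
    refine R.eq_of_rep_tensorVec hf ht (R.ext_inner_rvec fun ξ η => ?_)
    -- `s` is `Δ(ε_j)(Ω ⊗ Ω)` with its first leg paired with `ξ`. Since `T` commutes with
    -- translation, `s` is again an eigenvector for `μ`, so it expands in the `e k`; the
    -- coefficients are those of `v j k`.
    set s := ContinuousLinearMap.adjoint (rvecL R.rep R.rep ξ) (G.comulL R (e j)) with hs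
    have hinner : ∀ η, ⟪η, s⟫_ℂ = ⟪(rvec ξ η : R.tensorRep.space), G.comulL R (e j)⟫_ℂ := fun η => by
      rw [hs, ContinuousLinearMap.adjoint_inner_right, rvecL_apply]
    have hTadj : ContinuousLinearMap.adjoint T = T :=
      (G.convSq_isSymmetric R a).isSelfAdjoint
    have hsE : T s = μ • s := by
      refine ext_inner_left ℂ fun η => ?_
      have h1 : ⟪η, T s⟫_ℂ = ⟪T η, s⟫_ℂ := (G.convSq_isSymmetric R a η s).symm
      rw [h1, hinner, ← idTensor_rvec, inner_idTensor_left, hTadj, ← G.comulL_convSq R hH hf,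
        ← hT, (hmem _).mp (e j).2, map_smul, inner_smul_right, inner_smul_right, hinner]
    have h2 : ∀ k, ⟪(e k : R.rep.space), s⟫_ℂ = ⟪ξ, R.emb (v j k)⟫_ℂ := fun k => by
      rw [hinner, ← hemb, ← hemb, G.comulL_emb R hH, R.inner_rvec_emb_rep]
      rfl
    rw [← G.comulL_emb R hH, hemb, ← hinner, hexp s hsE, inner_sum, map_sum, sum_apply, inner_sum]
    refine Finset.sum_congr rfl fun k _ => ?_
    rw [R.rep_tmul_vec, inner_rvec, inner_smul_right, h2, hemb]
  refine ⟨_, ε, v, G.isUnitaryCorep_of_orthonormal R hH ht hf hε hv, hv, fun x hx => ?_⟩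
  rw [hexp x hx]
  exact Submodule.sum_mem _ fun k _ => Submodule.smul_mem _ _
    (Submodule.subset_span ⟨k, hemb k⟩)

/-! ### Density of `Pol(G)` -/

/-- The elements occurring in an orbit `Δ(εⱼ) = ∑ₖ vⱼₖ ⊗ εₖ` of a unitary corepresentation. -/
def corepVectors : Set A :=
  {x | ∃ (n : ℕ) (ε : Fin n → A) (v : Matrix (Fin n) (Fin n) A) (j : Fin n), G.IsUnitaryCorep v ∧
    (∀ j, G.comul (ε j) = ∑ k, tmul (v j k) (ε k)) ∧ x = ε j}

/-- Convolving `Δ(ε_j) = ∑ₖ v_jk ⊗ ε_k` gives `∑ₖ h(b ε_k) v_jk`. Only the coefficients `v_jk`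
enter, so it is not necessary to know that `ε_j` itself lies in `Pol(G)`, and no counit is required.
-/
theorem conv_mem_pol {x : A} (hx : x ∈ G.corepVectors) (b : A) :
    G.conv h (tmul 1 b) x ∈ G.pol := by
  obtain ⟨n, ε, v, j, hv, hε, rfl⟩ := hx
  rw [conv_apply, hε, Finset.mul_sum, map_sum]
  refine Submodule.sum_mem _ fun k _ => ?_
  rw [tmul_mul_tmul, one_mul, sliceRight_tmul]
  exact Submodule.smul_mem _ _ (hv.apply_mem_pol j k)

/-- The slice `id ⊗ h` is continuous and surjective, so it carries the dense span of `(1 ⊗ A)Δ(A)`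
to a dense subspace. -/
theorem dense_span_conv (h : State A) :
    Dense (Submodule.span ℂ {y | ∃ a x : A, y = G.conv h (tmul 1 a) x} : Set A) := by
  have hd : Dense (Submodule.span ℂ {x | ∃ a b : A, x = tmul 1 b * G.comul a} :
      Set (MinTensor A A)) := dense_span_star G.dense_left (by
    rintro _ ⟨a, b, rfl⟩
    exact ⟨star a, star b, by rw [star_mul, star_tmul, star_one, map_star]⟩)
  have hsurj : Function.Surjective (sliceRight A h : MinTensor A A →L[ℂ] A) := fun a =>
    ⟨tmul a 1, by rw [sliceRight_tmul, h.map_one, one_smul]⟩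
  refine (hsurj.denseRange.dense_image (sliceRight A h).continuous hd).mono ?_
  rintro _ ⟨z, hz, rfl⟩
  induction hz using Submodule.span_induction with
  | mem z hz =>
    obtain ⟨a, b, rfl⟩ := hz
    exact Submodule.subset_span ⟨b, a, rfl⟩
  | zero => rw [map_zero]; exact Submodule.zero_mem _
  | add x y _ _ hx hy => rw [map_add]; exact Submodule.add_mem _ hx hy
  | smul c x _ hx => rw [map_smul]; exact Submodule.smul_mem _ _ hx

/-- A vector `ξ` orthogonal to all these elements is orthogonal to every eigenspace of `K_a K_a⋆`
with non-zero eigenvalue, so `K_a K_a⋆ ξ = 0`, hence `K_a⋆ ξ = 0` for every `a`. Then `ξ` is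
orthogonal to the ranges of all `K_a`, whose span is dense. -/
theorem dense_span_emb_corepVectors (hH : G.IsHaarState h) (ht : h.IsTracial)
    (hf : h.IsFaithful) :
    Dense (Submodule.span ℂ (R.emb '' G.corepVectors) : Set R.rep.space) := by
  rw [Submodule.dense_iff_topologicalClosure_eq_top, Submodule.topologicalClosure_eq_top_iff,
    Submodule.eq_bot_iff]
  intro ξ hξ
  have h1 : ∀ a, G.convSq R a ξ = 0 := fun a => by
    refine apply_eq_zero_of_inner_eigenspace (G.isCompactOperator_convSq R hH hf a)
      (G.convSq_isSymmetric R a) fun μ hμ x hx => ?_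
    obtain ⟨n, ε, v, hv, hε, hE⟩ := G.exists_corep_eigenspace R hH ht hf a hμ
    refine (Submodule.mem_orthogonal _ _).mp hξ x (Submodule.span_mono ?_ (hE x hx))
    rintro _ ⟨j, rfl⟩
    exact ⟨ε j, ⟨n, ε, v, j, hv, hε, rfl⟩, rfl⟩
  have h2 : ∀ a, ContinuousLinearMap.adjoint (G.convOp R a) ξ = 0 := fun a => by
    have h3 : ⟪G.convSq R a ξ, ξ⟫_ℂ = 0 := by rw [h1, inner_zero_left]
    rw [convSq, ContinuousLinearMap.comp_apply, ← ContinuousLinearMap.adjoint_inner_right] at h3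
    exact inner_self_eq_zero.mp h3
  have h4 : ∀ y, ⟪R.emb y, ξ⟫_ℂ = 0 := by
    refine (G.dense_span_conv h).induction (P := fun y => ⟪R.emb y, ξ⟫_ℂ = 0) (fun y hy => ?_) ?_
    · induction hy using Submodule.span_induction with
      | mem y hy =>
        obtain ⟨a, x, rfl⟩ := hy
        rw [← G.convOp_emb R hH hf, ← ContinuousLinearMap.adjoint_inner_right, h2,
          inner_zero_right]
      | zero => simp
      | add x y _ _ hx hy => rw [map_add, inner_add_left, hx, hy, add_zero]
      | smul c x _ hx => rw [map_smul, inner_smul_left, hx, mul_zero]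
    · apply isClosed_eq <;> fun_prop
  exact R.denseRange_emb.eq_zero_of_inner_right ℂ h4

/-- `Pol(G)` is dense in `C(G)` if the Haar state is a faithful trace. -/
theorem dense_pol (R : h.GNSData) (hH : G.IsHaarState h) (ht : h.IsTracial) (hf : h.IsFaithful) :
    Dense (G.pol : Set A) := by
  -- The passage from Hilbert space density to norm density: `convL` is continuous into `A` and maps
  -- a dense subspace of the GNS space into `Pol(G)`.
  have h1 : ∀ b ξ, G.convL R (tmul 1 b) ξ ∈ G.pol.topologicalClosure := fun b ξ => by
    refine (G.dense_span_emb_corepVectors R hH ht hf).induction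
      (P := fun ξ => G.convL R (tmul 1 b) ξ ∈ G.pol.topologicalClosure) (fun ξ hξ => ?_)
      (G.pol.isClosed_topologicalClosure.preimage (G.convL R (tmul 1 b)).continuous) ξ
    have h2 : Submodule.span ℂ (R.emb '' G.corepVectors) ≤
        G.pol.comap (G.convL R (tmul 1 b)).toLinearMap := by
      refine Submodule.span_le.mpr ?_
      rintro _ ⟨x, hx, rfl⟩
      change G.convL R (tmul 1 b) (R.emb x) ∈ G.pol
      rw [G.convL_emb R hH hf]
      exact G.conv_mem_pol hx b
    exact G.pol.le_topologicalClosure (h2 hξ)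
  rw [← dense_closure, ← Submodule.topologicalClosure_coe]
  refine (G.dense_span_conv h).mono (Submodule.span_le.mpr ?_)
  rintro _ ⟨a, x, rfl⟩
  rw [← G.convL_emb R hH hf]
  exact h1 _ _

end CompactQuantumGroup

end

end CStarTensor

theorem theorem1p3 {A : Type u} [CStarAlgebra A] (G : CStarTensor.CompactQuantumGroup A)
    (h : CStarTensor.State A) (hHaar : G.IsHaarState h) (hKac : h.IsTracial)
    (hFaithful : h.IsFaithful) :
    closure (G.polCentral : Set A) = (G.central : Set A) ∧ G.polCentral = G.characterSpan := by
  obtain ⟨R⟩ := h.nonempty_gnsData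
  exact ⟨G.closure_polCentral R hHaar hKac hFaithful (G.dense_pol R hHaar hKac hFaithful),
    G.polCentral_eq_characterSpan R hHaar hKac hFaithful⟩
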